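/- For $\alpha,\beta>0$ and $\lambda=(\lambda_1,\dots,\lambda_n)\in\mathbb{R}^n$ with $\lambda_i\ge 0$ (any $n$), let $Q_\lambda=\sum_{i=1}^n\lambda_iX_i$, where $X_1,\dots,X_n$ are i.i.d. $\mathrm{Gamma}(\alpha,\beta)$ random variables (shape $\alpha$, rate $\beta$). For $\mu\ge\alpha$ let $$\mathcal{Q}_{\mathrm{rel}}(\mu;\alpha,\beta)=\Big\{Q_\lambda : \lambda_i\ge 0 \text{ for all } i,\ \tfrac{1}{\beta}\max_i\lambda_i\le\tfrac1\mu,\ \mathbb{E}[Q_\lambda]=1\Big\}.$$ For nonnegative vectors $\nu,\lambda$ (the shorter one padded with zeroes to the common length $n$) with decreasing rearrangements $\nu_{[1]}\ge\dots\ge\nu_{[n]}$ and $\lambda_{[1]}\ge\dots\ge\lambda_{[n]}$, write $\nu\preceq\lambda$ if $\sum_{i=1}^k\nu_{[i]}\le\sum_{i=1}^k\lambda_{[i]}$ for all $k\le n$ and $\sum_{i=1}^n\nu_i=\sum_{i=1}^n\lambda_i$. A mode of a distribution with a density is a point $x$ such that (a version of) the density is nondecreasing on $(-\infty,x)$ and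 nonincreasing on $(x,\infty)$. **Theorem.** Fix $\mu\ge\alpha>0$ and $\beta>0$. Consider the set of all modes of the distributions of $$Q_\lambda+\lambda_j\psi+\lambda_k\psi',\qquad Q_\lambda\in\mathcal{Q}_{\mathrm{rel}}(\mu;\alpha,\beta),\quad j\ne k,$$ where $\psi,\psi'$ are i.i.d. $\mathrm{Gamma}(1,\beta)$ and independent of $Q_\lambda$. This set is nonempty and bounded; let $\overline{x}_{\mathrm{upper}}$ and $\overline{x}_{\mathrm{lower}}$ be its supremum and infimum. If $Q_\lambda,Q_\nu\in\mathcal{Q}_{\mathrm{rel}}(\mu;\alpha,\beta)$ satisfy $\nu\preceq\lambda$, then $$\Pr(Q_\nu\le x)\ge\Pr(Q_\lambda\le x)\quad\text{for all } x\ge\overline{x}_{\mathrm{upper}},$$ $$\Pr(Q_\nu\le x)\le\Pr(Q_\lambda\le x)\quad\text{for all } x\le\overline{x}_{\mathrm{lower}}.$$ -/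

import Mathlib

open MeasureTheory ProbabilityTheory

noncomputable section

namespace GammaMix

/-- The law of `Q(w; α, β) = ∑ i, w i * X i`, where the `X i` are i.i.d. `Gamma(α, β)`
(shape `α`, rate `β`). -/
def law (α β : ℝ) {n : ℕ} (w : Fin n → ℝ) : Measure ℝ :=
  (Measure.pi fun _ : Fin n => gammaMeasure α β).map fun x => ∑ i, w i * x i

/-- The law of `Q(w; α, β) + w j * ψ + w k * ψ'`, where `ψ, ψ'` are i.i.d. `Gamma(1, β)`,
independent of `Q(w; α, β)`. -/
def lawAdd (α β : ℝ) {n : ℕ} (w : Fin n → ℝ) (j k : Fin n) : Measure ℝ :=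
  ((Measure.pi fun _ : Fin n => gammaMeasure α β).prod
    ((gammaMeasure 1 β).prod (gammaMeasure 1 β))).map
      fun p => ∑ i, w i * p.1 i + w j * p.2.1 + w k * p.2.2

/-- `scale(Q(w; α, β)) = max_i |w i| / β`. -/
def scale (β : ℝ) {n : ℕ} (w : Fin n → ℝ) : ℝ :=
  (⨆ i, |w i|) / β

/-- `Q(w; α, β)` belongs to the family `Q_rel(m; α, β)`: nonnegative weights, scale at most
`1 / m`, expectation one. (The length `n` of `w` is arbitrary.) -/
structure MemQrel (m α β : ℝ) {n : ℕ} (w : Fin n → ℝ) : Prop where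
  nonneg : ∀ i, 0 ≤ w i
  scale_le : scale β w ≤ 1 / m
  mean_eq_one : ∫ x, x ∂(law α β w) = 1

/-- `x` is a mode of the probability density of `P`: some version `f` of the density of `P` is
nondecreasing to the left of `x` and nonincreasing to the right of `x`. No condition is put on
the value at `x` itself, so that a density that blows up at `x` (such as that of `Gamma(α, β)`
with `α < 1` at `0`) is covered. -/
def IsMode (P : Measure ℝ) (x : ℝ) : Prop :=
  ∃ f : ℝ → ENNReal, Measurable f ∧ P = volume.withDensity f ∧
    MonotoneOn f (Set.Iio x) ∧ AntitoneOn f (Set.Ioi x)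

/-- All modes of the laws of `Q_w + w j * ψ + w k * ψ'`, `Q_w ∈ Q_rel(m; α, β)`, `j ≠ k`. -/
def modes (m α β : ℝ) : Set ℝ :=
  {x | ∃ (n : ℕ) (w : Fin n → ℝ) (j k : Fin n),
    MemQrel m α β w ∧ j ≠ k ∧ IsMode (lawAdd α β w j k) x}

/-- The upper extreme value of the mode. -/
def xUpper (m α β : ℝ) : ℝ := sSup (modes m α β)

/-- The lower extreme value of the mode. -/
def xLower (m α β : ℝ) : ℝ := sInf (modes m α β)

/-- The entries of `v` in nonincreasing order (indexed from `0`), padded with zeroes. -/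
def sorted {n : ℕ} (v : Fin n → ℝ) (i : ℕ) : ℝ :=
  if h : i < n then v (Tuple.sort (fun a => -v a) ⟨i, h⟩) else 0

/-- `u ⪯ v`: the nonnegative vector `v` majorizes the nonnegative vector `u`, the shorter of the
two being padded with zeroes. -/
def Majorizes {n₁ n₂ : ℕ} (v : Fin n₂ → ℝ) (u : Fin n₁ → ℝ) : Prop :=
  (∀ k ≤ max n₁ n₂, ∑ i ∈ Finset.range k, sorted u i ≤ ∑ i ∈ Finset.range k, sorted v i) ∧
    ∑ i, u i = ∑ i, v i

end GammaMix

end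

namespace GammaMix

open Set Filter Topology Real

/-- A nonnegative integrable function `f` on the line, positive somewhere on `(0, ∞)`, such that
`z * f z = ∫ y in 0..z, k (z - y) * f y` for `z > 0`, where `k y = ∑ i, κ i * exp (-(b i * y))`. -/
structure ExpRenewal {ι : Type*} [Fintype ι] (κ b : ι → ℝ) (f : ℝ → ℝ) : Prop where
  shape_pos : ∀ i, 0 < κ i
  rate_pos : ∀ i, 0 < b i
  nonneg : ∀ x, 0 ≤ f x
  integrable : Integrable f
  mass_pos : 0 < ∫ x in Ioi 0, f x
  eqn : ∀ z, 0 < z → z * f z = ∑ i, κ i * ∫ y in (0 : ℝ)..z, exp (-(b i * (z - y))) * f y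

/-- The convolution of `f` on `(0, z)` with the exponential kernel of rate `c`. -/
noncomputable def expConv (f : ℝ → ℝ) (c z : ℝ) : ℝ :=
  ∫ y in (0 : ℝ)..z, exp (-(c * (z - y))) * f y

lemma expConv_eq (f : ℝ → ℝ) (c z : ℝ) :
    expConv f c z = exp (-(c * z)) * ∫ y in (0 : ℝ)..z, exp (c * y) * f y := by
  rw [expConv, ← intervalIntegral.integral_const_mul]
  congr 1; ext y
  rw [← mul_assoc, ← exp_add]; ring_nf

lemma expConv_eq_comp_sub (f : ℝ → ℝ) (c z : ℝ) :
    expConv f c z = ∫ y in (0 : ℝ)..z, exp (-(c * y)) * f (z - y) := by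
  have := intervalIntegral.integral_comp_sub_left (a := 0) (b := z)
    (fun y => exp (-(c * (z - y))) * f y) z
  simp only [sub_sub_cancel, sub_self, sub_zero] at this
  rw [expConv, ← this]

lemma intervalIntegrable_mul_of_continuous {f g : ℝ → ℝ} (hf : Integrable f) (hg : Continuous g)
    (x y : ℝ) : IntervalIntegrable (fun t => g t * f t) volume x y :=
  hf.intervalIntegrable.continuousOn_mul hg.continuousOn

lemma continuous_expConv {f : ℝ → ℝ} (hf : Integrable f) (c : ℝ) : Continuous (expConv f c) := by
  have : expConv f c = fun z => exp (-(c * z)) * ∫ y in (0 : ℝ)..z, exp (c * y) * f y :=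
    funext (expConv_eq f c)
  rw [this]
  refine Continuous.mul (by fun_prop) (intervalIntegral.continuous_primitive
    (fun x y => intervalIntegrable_mul_of_continuous hf (by fun_prop) x y) 0)

lemma hasDerivAt_expConv {f : ℝ → ℝ} (hf : Integrable f) (c : ℝ) {z : ℝ}
    (hz : ContinuousAt f z) :
    HasDerivAt (expConv f c) (f z - c * expConv f c z) z := by
  have : expConv f c = fun z => exp (-(c * z)) * ∫ y in (0 : ℝ)..z, exp (c * y) * f y :=
    funext (expConv_eq f c)
  have h1 : HasDerivAt (fun z => ∫ y in (0 : ℝ)..z, exp (c * y) * f y) (exp (c * z) * f z) z := by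
    refine intervalIntegral.integral_hasDerivAt_right
      (intervalIntegrable_mul_of_continuous hf (by fun_prop) 0 z) ?_ ?_
    · have : AEStronglyMeasurable (fun y => exp (c * y) * f y) volume :=
        (Continuous.aestronglyMeasurable (by fun_prop)).mul hf.aestronglyMeasurable
      exact this.stronglyMeasurableAtFilter
    · exact ContinuousAt.mul (by fun_prop) hz
  have h2 : HasDerivAt (fun z => exp (-(c * z))) (exp (-(c * z)) * (-(c * 1))) z :=
    (((hasDerivAt_id z).const_mul c).neg).exp
  rw [this]
  refine (h2.mul h1).congr_deriv ?_
  have h3 : exp (-(c * z)) * exp (c * z) = 1 := by rw [← exp_add]; simp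
  linear_combination (f z) * h3

lemma intervalIntegrable_expConv {f : ℝ → ℝ} (hf : Integrable f) (c z x y : ℝ) :
    IntervalIntegrable (fun t => exp (-(c * (z - t))) * f t) volume x y :=
  intervalIntegrable_mul_of_continuous hf (by fun_prop) x y

lemma intervalIntegrable_expConv_comp_sub {f : ℝ → ℝ} (hf : Integrable f) (c z x y : ℝ) :
    IntervalIntegrable (fun t => exp (-(c * t)) * f (z - t)) volume x y :=
  intervalIntegrable_mul_of_continuous (hf.comp_sub_left z) (by fun_prop) x y

namespace ExpRenewal

variable {ι : Type*} [Fintype ι] {κ b : ι → ℝ} {f : ℝ → ℝ}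

lemma eqn' (h : ExpRenewal κ b f) {z : ℝ} (hz : 0 < z) :
    z * f z = ∑ i, κ i * expConv f (b i) z := h.eqn z hz

lemma expConv_nonneg (h : ExpRenewal κ b f) (i : ι) {z : ℝ} (hz : 0 ≤ z) :
    0 ≤ expConv f (b i) z :=
  intervalIntegral.integral_nonneg hz fun y _ => mul_nonneg (exp_pos _).le (h.nonneg y)

lemma expConv_le (h : ExpRenewal κ b f) (i : ι) {z : ℝ} (hz : 0 ≤ z) :
    expConv f (b i) z ≤ ∫ y in (0 : ℝ)..z, f y := by
  refine intervalIntegral.integral_mono_on hz (intervalIntegrable_expConv h.integrable _ _ _ _)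
    h.integrable.intervalIntegrable fun y hy => ?_
  refine mul_le_of_le_one_left (h.nonneg y) (exp_le_one_iff.2 ?_)
  have := mul_nonneg (h.rate_pos i).le (sub_nonneg.2 hy.2)
  linarith

lemma le_expConv (h : ExpRenewal κ b f) (i : ι) {z : ℝ} (hz : 0 ≤ z) :
    exp (-(b i * z)) * ∫ y in (0 : ℝ)..z, f y ≤ expConv f (b i) z := by
  rw [← intervalIntegral.integral_const_mul]
  refine intervalIntegral.integral_mono_on hz (h.integrable.intervalIntegrable.const_mul _)
    (intervalIntegrable_expConv h.integrable _ _ _ _) fun y hy => ?_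
  refine mul_le_mul_of_nonneg_right (exp_le_exp.2 ?_) (h.nonneg y)
  have := mul_nonneg (h.rate_pos i).le hy.1
  linarith

lemma continuousAt (h : ExpRenewal κ b f) {z : ℝ} (hz : 0 < z) : ContinuousAt f z := by
  have h1 : ContinuousAt (fun z => (∑ i, κ i * expConv f (b i) z) / z) z := by
    refine ContinuousAt.div (Continuous.continuousAt ?_) continuousAt_id hz.ne'
    exact continuous_finsetSum _ fun i _ => (continuous_expConv h.integrable _).const_mul _
  refine h1.congr ?_
  filter_upwards [lt_mem_nhds hz] with y hy
  rw [← h.eqn' hy]; field_simp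

/-- `z` times the derivative of `f` at `z`. -/
noncomputable def slopeNum (κ b : ι → ℝ) (f : ℝ → ℝ) (z : ℝ) : ℝ :=
  (∑ i, κ i - 1) * f z - ∑ i, κ i * b i * expConv f (b i) z

lemma hasDerivAt (h : ExpRenewal κ b f) {z : ℝ} (hz : 0 < z) :
    HasDerivAt f (slopeNum κ b f z / z) z := by
  have h1 : HasDerivAt (fun z => ∑ i, κ i * expConv f (b i) z)
      (∑ i, κ i * (f z - b i * expConv f (b i) z)) z :=
    HasDerivAt.fun_sum fun i _ =>
      (hasDerivAt_expConv h.integrable _ (h.continuousAt hz)).const_mul _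
  have h2 := h1.div (hasDerivAt_id z) hz.ne'
  refine (h2.congr_of_eventuallyEq ?_).congr_deriv ?_
  · filter_upwards [lt_mem_nhds hz] with y hy
    simp only [Pi.div_apply, id]
    rw [← h.eqn' hy]; field_simp
  · simp only [id]
    rw [← h.eqn' hz, slopeNum]
    simp only [mul_sub, Finset.sum_sub_distrib, ← Finset.sum_mul, ← mul_assoc]
    field_simp
    ring

lemma continuousAt_slopeNum (h : ExpRenewal κ b f) {z : ℝ} (hz : 0 < z) :
    ContinuousAt (slopeNum κ b f) z := by
  refine ((h.continuousAt hz).const_mul _).sub (Continuous.continuousAt ?_)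
  exact continuous_finsetSum _ fun i _ => (continuous_expConv h.integrable _).const_mul _

lemma primitive_pos (h : ExpRenewal κ b f) {z : ℝ} (hz : 0 < z) :
    0 < ∫ y in (0 : ℝ)..z, f y := by
  set F : ℝ → ℝ := fun z => ∫ y in (0 : ℝ)..z, f y with hF
  have hFd : ∀ x, 0 < x → HasDerivAt F (f x) x := fun x hx =>
    intervalIntegral.integral_hasDerivAt_right h.integrable.intervalIntegrable
      h.integrable.aestronglyMeasurable.stronglyMeasurableAtFilter (h.continuousAt hx)
  have hFnn : ∀ x, 0 ≤ x → 0 ≤ F x := fun x hx =>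
    intervalIntegral.integral_nonneg hx fun y _ => h.nonneg y
  refine lt_of_le_of_ne (hFnn z hz.le) fun h0 => ?_
  set c := (∑ i, κ i) / z with hc
  have hK : 0 ≤ ∑ i, κ i := Finset.sum_nonneg fun i _ => (h.shape_pos i).le
  have hG : AntitoneOn (fun x => F x * exp (-(c * x))) (Ici z) := by
    have hd : ∀ x, 0 < x → HasDerivAt (fun x => F x * exp (-(c * x)))
        (f x * exp (-(c * x)) + F x * (exp (-(c * x)) * (-(c * 1)))) x := fun x hx =>
      (hFd x hx).mul (((hasDerivAt_id x).const_mul c).neg).exp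
    refine antitoneOn_of_deriv_nonpos (convex_Ici z)
      (fun x hx => (hd x (hz.trans_le hx)).continuousAt.continuousWithinAt)
      (fun x hx => ?_) fun x hx => ?_
    · rw [interior_Ici] at hx
      exact (hd x (hz.trans hx)).differentiableAt.differentiableWithinAt
    · rw [interior_Ici] at hx
      have hx0 : 0 < x := hz.trans hx
      rw [(hd x hx0).deriv]
      have h1 : x * f x ≤ (∑ i, κ i) * F x := by
        rw [h.eqn' hx0, Finset.sum_mul]
        exact Finset.sum_le_sum fun i _ =>
          mul_le_mul_of_nonneg_left (h.expConv_le i hx0.le) (h.shape_pos i).le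
      have h2 : z * f x ≤ x * f x := mul_le_mul_of_nonneg_right (le_of_lt hx) (h.nonneg x)
      have h3 : f x ≤ c * F x := by
        rw [hc, div_mul_eq_mul_div, le_div_iff₀ hz]; linarith
      have := mul_le_mul_of_nonneg_right h3 (exp_pos (-(c * x))).le
      linarith
  have hz0 : ∀ x, z ≤ x → F x = 0 := fun x hx => by
    have h1 := hG self_mem_Ici hx hx
    simp only [hF] at h1
    rw [← h0, zero_mul] at h1
    exact le_antisymm (nonpos_of_mul_nonpos_left h1 (exp_pos _)) (hFnn x (hz.le.trans hx))
  have hlim : Tendsto F atTop (𝓝 (∫ x in Ioi 0, f x)) :=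
    intervalIntegral_tendsto_integral_Ioi 0 h.integrable.integrableOn tendsto_id
  have hlim0 : Tendsto F atTop (𝓝 0) := by
    refine tendsto_const_nhds.congr' ?_
    filter_upwards [eventually_ge_atTop z] with x hx
    exact (hz0 x hx).symm
  exact h.mass_pos.ne' (tendsto_nhds_unique hlim hlim0)

lemma pos [Nonempty ι] (h : ExpRenewal κ b f) {z : ℝ} (hz : 0 < z) : 0 < f z := by
  have : 0 < z * f z := by
    rw [h.eqn' hz]
    refine Finset.sum_pos (fun i _ => mul_pos (h.shape_pos i) ?_) Finset.univ_nonempty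
    exact (mul_pos (exp_pos _) (h.primitive_pos hz)).trans_le (h.le_expConv i hz.le)
  exact pos_of_mul_pos_right this hz.le

lemma nonempty_of_one_lt_sum (hκ : 1 < ∑ i, κ i) : Nonempty ι := by
  by_contra hι
  rw [not_nonempty_iff] at hι
  simp at hκ
  linarith

lemma exists_slopeNum_pos (h : ExpRenewal κ b f) (hκ : 1 < ∑ i, κ i) :
    ∃ ε > 0, ∀ z, 0 < z → z < ε → 0 < slopeNum κ b f z := by
  have := nonempty_of_one_lt_sum hκ
  have hB : 0 < ∑ i, b i := Finset.sum_pos (fun i _ => h.rate_pos i) Finset.univ_nonempty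
  refine ⟨(∑ i, κ i - 1) / ∑ i, b i, div_pos (by linarith) hB, fun z hz hz' => ?_⟩
  have h1 : ∑ i, κ i * b i * expConv f (b i) z ≤ (∑ i, b i) * (z * f z) := by
    rw [h.eqn' hz, Finset.mul_sum]
    refine Finset.sum_le_sum fun i _ => ?_
    have h2 : b i ≤ ∑ i, b i :=
      Finset.single_le_sum (f := b) (fun i _ => (h.rate_pos i).le) (Finset.mem_univ i)
    have h3 := mul_nonneg (h.shape_pos i).le (h.expConv_nonneg i hz.le)
    nlinarith
  rw [lt_div_iff₀ hB] at hz'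
  have := h.pos hz
  rw [slopeNum]
  nlinarith

lemma monotoneOn_of_slopeNum_nonneg (h : ExpRenewal κ b f) {s : Set ℝ} (hs : Convex ℝ s)
    (hpos : ∀ x ∈ s, 0 < x) (hD : ∀ x ∈ interior s, 0 ≤ slopeNum κ b f x) : MonotoneOn f s := by
  refine monotoneOn_of_deriv_nonneg hs
    (fun x hx => (h.continuousAt (hpos x hx)).continuousWithinAt)
    (fun x hx =>
      (h.hasDerivAt (hpos x (interior_subset hx))).differentiableAt.differentiableWithinAt)
    fun x hx => ?_
  rw [(h.hasDerivAt (hpos x (interior_subset hx))).deriv]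
  exact div_nonneg (hD x hx) (hpos x (interior_subset hx)).le

lemma antitoneOn_of_slopeNum_nonpos (h : ExpRenewal κ b f) {s : Set ℝ} (hs : Convex ℝ s)
    (hpos : ∀ x ∈ s, 0 < x) (hD : ∀ x ∈ interior s, slopeNum κ b f x ≤ 0) : AntitoneOn f s := by
  refine antitoneOn_of_deriv_nonpos hs
    (fun x hx => (h.continuousAt (hpos x hx)).continuousWithinAt)
    (fun x hx =>
      (h.hasDerivAt (hpos x (interior_subset hx))).differentiableAt.differentiableWithinAt)
    fun x hx => ?_
  rw [(h.hasDerivAt (hpos x (interior_subset hx))).deriv]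
  exact div_nonpos_of_nonpos_of_nonneg (hD x hx) (hpos x (interior_subset hx)).le

lemma exists_slopeNum_neg [Nonempty ι] (h : ExpRenewal κ b f) :
    ∃ z, 0 < z ∧ slopeNum κ b f z < 0 := by
  by_contra! hD
  have hm := h.monotoneOn_of_slopeNum_nonneg (convex_Ioi 0) (fun x hx => hx)
    (fun x hx => by rw [interior_Ioi] at hx; exact hD x hx)
  have h1 : IntegrableOn (fun _ => f 1) (Ioi (1 : ℝ)) := by
    refine Integrable.mono' h.integrable.integrableOn aestronglyMeasurable_const ?_
    refine (ae_restrict_iff' measurableSet_Ioi).2 (ae_of_all _ fun x hx => ?_)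
    rw [norm_of_nonneg (h.nonneg 1)]
    exact hm (mem_Ioi.2 one_pos) (mem_Ioi.2 (one_pos.trans hx)) (le_of_lt hx)
  rw [integrableOn_const_iff] at h1
  simp [(h.pos one_pos).ne'] at h1

/-- Comparison of the kernel averages at a point `x` up to which `f` is increasing and at a later
point `y` where `f` is minimal on `[x, y]`. -/
lemma expConv_mul_lt [Nonempty ι] (h : ExpRenewal κ b f) {x y : ℝ} (hx : 0 < x) (hxy : x < y)
    (hm : MonotoneOn f (Ioc 0 x)) (hmin : ∀ z ∈ Icc x y, f y ≤ f z) (i : ι) :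
    expConv f (b i) x * f y < expConv f (b i) y * f x := by
  have hy := hx.trans hxy
  rw [expConv_eq_comp_sub f (b i) y, expConv_eq_comp_sub f (b i) x]
  have hii := fun z s t => intervalIntegrable_expConv_comp_sub h.integrable (b i) z s t
  rw [← intervalIntegral.integral_add_adjacent_intervals (hii y 0 x) (hii y x y), add_mul]
  have h1 : (∫ t in (0 : ℝ)..x, exp (-(b i * t)) * f (x - t)) * f y ≤
      (∫ t in (0 : ℝ)..x, exp (-(b i * t)) * f (y - t)) * f x := by
    rw [← intervalIntegral.integral_mul_const, ← intervalIntegral.integral_mul_const]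
    refine intervalIntegral.integral_mono_on_of_le_Ioo hx.le ((hii x 0 x).mul_const _)
      ((hii y 0 x).mul_const _) fun t ht => ?_
    rw [mul_assoc, mul_assoc]
    refine mul_le_mul_of_nonneg_left ?_ (exp_pos _).le
    have hxt : f (x - t) ≤ f x := hm ⟨by linarith [ht.2], by linarith [ht.1]⟩ ⟨hx, le_rfl⟩
      (by linarith [ht.1])
    have hyx : f y ≤ f x := hmin x ⟨le_rfl, hxy.le⟩
    rcases le_total t (y - x) with hle | hle
    · have := hmin (y - t) ⟨by linarith, by linarith [ht.1]⟩
      rw [mul_comm]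
      exact mul_le_mul this hxt (h.nonneg _) (h.nonneg _)
    · have := hm (a := x - t) (b := y - t) ⟨by linarith [ht.2], by linarith [ht.1]⟩
        ⟨by linarith [ht.2], by linarith⟩ (by linarith)
      exact mul_le_mul this hyx (h.nonneg _) (h.nonneg _)
  have h2 : 0 < (∫ t in x..y, exp (-(b i * t)) * f (y - t)) * f x := by
    refine mul_pos (intervalIntegral.intervalIntegral_pos_of_pos_on (hii y x y) (fun t ht => ?_)
      hxy) (h.pos hx)
    exact mul_pos (exp_pos _) (h.pos (by linarith [ht.2]))
  linarith

lemma slopeNum_mul_lt [Nonempty ι] (h : ExpRenewal κ b f) {x y : ℝ} (hx : 0 < x) (hxy : x < y)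
    (hm : MonotoneOn f (Ioc 0 x)) (hmin : ∀ z ∈ Icc x y, f y ≤ f z) :
    slopeNum κ b f y * f x < slopeNum κ b f x * f y := by
  have : ∑ i, κ i * b i * expConv f (b i) x * f y < ∑ i, κ i * b i * expConv f (b i) y * f x := by
    refine Finset.sum_lt_sum_of_nonempty Finset.univ_nonempty fun i _ => ?_
    rw [mul_assoc, mul_assoc _ (expConv f (b i) y)]
    exact mul_lt_mul_of_pos_left (h.expConv_mul_lt hx hxy hm hmin i)
      (mul_pos (h.shape_pos i) (h.rate_pos i))
  rw [← Finset.sum_mul, ← Finset.sum_mul] at this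
  rw [slopeNum, slopeNum]
  linarith

lemma rate_mul_expConv_lt [Nonempty ι] (h : ExpRenewal κ b f) {x : ℝ} (hx : 0 < x)
    (hm : MonotoneOn f (Ioc 0 x)) (i : ι) : b i * expConv f (b i) x < f x := by
  have hb := h.rate_pos i
  have h0 : expConv f (b i) x ≤ ∫ y in (0 : ℝ)..x, exp (-(b i * (x - y))) * f x := by
    refine intervalIntegral.integral_mono_on_of_le_Ioo hx.le
      (intervalIntegrable_expConv h.integrable _ _ _ _)
      (Continuous.intervalIntegrable (by fun_prop) _ _) fun t ht => ?_
    exact mul_le_mul_of_nonneg_left (hm ⟨ht.1, ht.2.le⟩ ⟨hx, le_rfl⟩ ht.2.le) (exp_pos _).le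
  have h1 : ∫ y in (0 : ℝ)..x, exp (-(b i * (x - y))) * f x
      = f x * ((1 - exp (-(b i * x))) / b i) := by
    have hd : ∀ y ∈ uIcc 0 x, HasDerivAt (fun y => exp (-(b i * (x - y))) / b i * f x)
        (exp (-(b i * (x - y))) * f x) y := fun y _ => by
      have := ((((hasDerivAt_id y).const_sub x).const_mul (b i)).neg.exp.div_const
        (b i)).mul_const (f x)
      refine this.congr_deriv ?_
      simp only [id, Pi.neg_apply]
      field_simp
    rw [intervalIntegral.integral_eq_sub_of_hasDerivAt hd
      (Continuous.intervalIntegrable (by fun_prop) _ _)]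
    simp
    ring
  rw [h1] at h0
  have h2 := mul_le_mul_of_nonneg_left h0 hb.le
  have h3 : b i * (f x * ((1 - exp (-(b i * x))) / b i)) = f x - f x * exp (-(b i * x)) := by
    field_simp
  have := mul_pos (h.pos hx) (exp_pos (-(b i * x)))
  linarith

/-- Right of a critical point up to which `f` is increasing, `f` decreases. -/
lemma eventually_slopeNum_neg [Nonempty ι] (h : ExpRenewal κ b f) {x : ℝ} (hx : 0 < x)
    (hm : MonotoneOn f (Ioc 0 x)) (h0 : slopeNum κ b f x = 0) :
    ∀ᶠ z in 𝓝[>] x, slopeNum κ b f z < 0 := by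
  have hd : HasDerivAt (slopeNum κ b f)
      ((∑ i, κ i - 1) * (slopeNum κ b f x / x) -
        ∑ i, κ i * b i * (f x - b i * expConv f (b i) x)) x :=
    ((h.hasDerivAt hx).const_mul _).sub (HasDerivAt.fun_sum fun i _ =>
      (hasDerivAt_expConv h.integrable _ (h.continuousAt hx)).const_mul _)
  have hneg : (∑ i, κ i - 1) * (slopeNum κ b f x / x) -
        ∑ i, κ i * b i * (f x - b i * expConv f (b i) x) < 0 := by
    rw [h0, zero_div, mul_zero, zero_sub, neg_lt_zero]
    refine Finset.sum_pos (fun i _ => ?_) Finset.univ_nonempty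
    exact mul_pos (mul_pos (h.shape_pos i) (h.rate_pos i))
      (sub_pos.2 (h.rate_mul_expConv_lt hx hm i))
  have hs := (hasDerivAt_iff_tendsto_slope.1 hd).eventually (gt_mem_nhds hneg)
  have hs' := hs.filter_mono (nhdsWithin_mono x (fun z (hz : x < z) => hz.ne'))
  filter_upwards [hs', self_mem_nhdsWithin] with z hz hxz
  rw [slope_def_field, h0, sub_zero] at hz
  exact (div_neg_iff.1 hz).elim (fun hh => absurd hh.2 (by simpa using le_of_lt hxz)) fun hh => hh.1

/-- Solutions of the renewal equation of total shape larger than one are unimodal. -/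
theorem exists_mode (h : ExpRenewal κ b f) (hκ : 1 < ∑ i, κ i) :
    ∃ a > 0, MonotoneOn f (Ioc 0 a) ∧ AntitoneOn f (Ici a) := by
  have := nonempty_of_one_lt_sum hκ
  obtain ⟨ε, hε, hεD⟩ := h.exists_slopeNum_pos hκ
  set S := {z | 0 < z ∧ slopeNum κ b f z < 0} with hS
  have hSne : S.Nonempty := h.exists_slopeNum_neg
  have hSlb : ∀ z ∈ S, ε ≤ z := fun z hz => by
    by_contra! hlt
    exact absurd (hεD z hz.1 hlt) hz.2.not_gt
  have hbdd : BddBelow S := ⟨ε, hSlb⟩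
  set a := sInf S with ha
  have ha0 : 0 < a := hε.trans_le (le_csInf hSne hSlb)
  have hleft : ∀ z, 0 < z → z < a → 0 ≤ slopeNum κ b f z := fun z hz hza => by
    by_contra! hlt
    exact absurd (csInf_le hbdd (show z ∈ S from ⟨hz, hlt⟩)) hza.not_ge
  have hmono : MonotoneOn f (Ioc 0 a) :=
    h.monotoneOn_of_slopeNum_nonneg (convex_Ioc 0 a) (fun x hx => hx.1)
      (fun x hx => by rw [interior_Ioc] at hx; exact hleft x hx.1 hx.2)
  have hca := h.continuousAt_slopeNum ha0
  have hDa : slopeNum κ b f a = 0 := by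
    refine le_antisymm ?_ ?_
    · by_contra! hpos
      have hev : ∀ᶠ z in 𝓝 a, 0 < slopeNum κ b f z := hca.eventually (lt_mem_nhds hpos)
      obtain ⟨z, hz, hzS⟩ := ((mem_closure_iff_frequently.1
        (csInf_mem_closure hSne hbdd)).and_eventually hev).exists
      exact absurd hzS hz.2.not_gt
    · refine ge_of_tendsto (hca.tendsto.mono_left (nhdsWithin_le_nhds (s := Iio a))) ?_
      filter_upwards [self_mem_nhdsWithin, nhdsWithin_le_nhds (lt_mem_nhds ha0)] with z hz hz0
      exact hleft z hz0 hz
  refine ⟨a, ha0, hmono, h.antitoneOn_of_slopeNum_nonpos (convex_Ici a)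
    (fun x hx => ha0.trans_le hx) fun c hc => ?_⟩
  rw [interior_Ici] at hc
  by_contra! hDc
  obtain ⟨y, hy, hymin⟩ := isCompact_Icc.exists_isMinOn (nonempty_Icc.2 (le_of_lt hc))
    (f := f) (fun x hx => (h.continuousAt (ha0.trans_le hx.1)).continuousWithinAt)
  rcases hy.1.eq_or_lt with rfl | hay
  · obtain ⟨δ, hδ, hδD⟩ := mem_nhdsGT_iff_exists_Ioo_subset.1
      (h.eventually_slopeNum_neg ha0 hmono hDa)
    set d := min ((a + δ) / 2) c with hd
    have hδ' : a < δ := hδ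
    have had : a < d := lt_min (by linarith) hc
    have hdδ : d < δ := (min_le_left _ _).trans_lt (by linarith)
    have hstrict : StrictAntiOn f (Icc a d) := by
      refine strictAntiOn_of_deriv_neg (convex_Icc a d)
        (fun x hx => (h.continuousAt (ha0.trans_le hx.1)).continuousWithinAt) fun x hx => ?_
      rw [interior_Icc] at hx
      rw [(h.hasDerivAt (ha0.trans hx.1)).deriv]
      exact div_neg_of_neg_of_pos (hδD ⟨hx.1, hx.2.trans hdδ⟩) (ha0.trans hx.1)
    have h1 := hstrict (left_mem_Icc.2 had.le) (right_mem_Icc.2 had.le) had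
    exact absurd (hymin ⟨had.le, min_le_right _ _⟩) h1.not_ge
  · have h1 := h.slopeNum_mul_lt ha0 hay hmono
      (fun z hz => hymin ⟨hz.1, hz.2.trans hy.2⟩)
    rw [hDa, zero_mul] at h1
    have hneg : slopeNum κ b f y < 0 := neg_of_mul_neg_left h1 (h.pos ha0).le
    rcases hy.2.eq_or_lt with rfl | hyc
    · linarith
    · have hloc : IsLocalMin f y := hymin.isLocalMin (Icc_mem_nhds hay hyc)
      have := hloc.hasDerivAt_eq_zero (h.hasDerivAt (ha0.trans hay))
      rw [div_eq_zero_iff] at this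
      rcases this with h2 | h2 <;> linarith

end ExpRenewal

/-- The law of `∑ i, w i * X i`, where the `X i` are independent and `X i` is `Gamma(κ i, β)`. -/
noncomputable def genLaw {n : ℕ} (κ : Fin n → ℝ) (β : ℝ) (w : Fin n → ℝ) : Measure ℝ :=
  (Measure.pi fun i => gammaMeasure (κ i) β).map fun x => ∑ i, w i * x i

@[fun_prop]
lemma measurable_weightedSum {n : ℕ} (w : Fin n → ℝ) :
    Measurable fun x : Fin n → ℝ => ∑ i, w i * x i := by fun_prop

/-- The law of `c * ψ`, where `ψ` is `Gamma(1, β)`. -/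
noncomputable def expLaw (β c : ℝ) : Measure ℝ := (gammaMeasure 1 β).map fun y => c * y

lemma isProbabilityMeasure_expLaw {β : ℝ} (hβ : 0 < β) (c : ℝ) :
    IsProbabilityMeasure (expLaw β c) := by
  have := isProbabilityMeasure_gammaMeasure one_pos hβ
  exact Measure.isProbabilityMeasure_map (by fun_prop)

lemma isProbabilityMeasure_genLaw {n : ℕ} {κ : Fin n → ℝ} {β : ℝ} (hκ : ∀ i, 0 < κ i)
    (hβ : 0 < β) (w : Fin n → ℝ) : IsProbabilityMeasure (genLaw κ β w) := by
  have := fun i => isProbabilityMeasure_gammaMeasure (hκ i) hβ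
  exact Measure.isProbabilityMeasure_map (measurable_weightedSum w).aemeasurable

lemma law_eq_genLaw (α β : ℝ) {n : ℕ} (w : Fin n → ℝ) : law α β w = genLaw (fun _ => α) β w := rfl

lemma charFun_genLaw {n : ℕ} {κ : Fin n → ℝ} {β : ℝ} (hκ : ∀ i, 0 < κ i)
    (hβ : 0 < β) (w : Fin n → ℝ) (t : ℝ) :
    charFun (genLaw κ β w) t = ∏ i, charFun (gammaMeasure (κ i) β) (w i * t) := by
  have := fun i => isProbabilityMeasure_gammaMeasure (hκ i) hβ
  simp_rw [charFun_apply_real]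
  rw [genLaw, integral_map (measurable_weightedSum w).aemeasurable (by fun_prop),
    ← integral_fintype_prod_eq_prod]
  congr 1; ext x
  rw [← Complex.exp_sum]
  congr 1
  push_cast
  rw [Finset.mul_sum, Finset.sum_mul]
  exact Finset.sum_congr rfl fun i _ => by ring

lemma genLaw_cons {n : ℕ} {κ : Fin n → ℝ} {β a c : ℝ} (hκ : ∀ i, 0 < κ i) (ha : 0 < a)
    (hβ : 0 < β) (w : Fin n → ℝ) :
    genLaw (Fin.cons a κ : Fin (n + 1) → ℝ) β (Fin.cons c w : Fin (n + 1) → ℝ) =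
      genLaw κ β w ∗ (gammaMeasure a β).map (fun y => c * y) := by
  have := isProbabilityMeasure_gammaMeasure ha hβ
  have hκ' : ∀ i, 0 < (Fin.cons a κ : Fin (n + 1) → ℝ) i := Fin.cases ha hκ
  have := isProbabilityMeasure_genLaw hκ hβ w
  have := isProbabilityMeasure_genLaw hκ' hβ (Fin.cons c w : Fin (n + 1) → ℝ)
  have : IsProbabilityMeasure ((gammaMeasure a β).map (fun y => c * y)) :=
    Measure.isProbabilityMeasure_map (by fun_prop)
  refine Measure.ext_of_charFun (funext fun t => ?_)
  rw [charFun_conv, charFun_genLaw hκ hβ, charFun_genLaw hκ' hβ, charFun_map_mul,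
    Fin.prod_univ_succ, mul_comm]
  simp

lemma lawAdd_eq_conv {α β : ℝ} (hα : 0 < α) (hβ : 0 < β) {n : ℕ} (w : Fin n → ℝ) (j k : Fin n) :
    lawAdd α β w j k = (law α β w ∗ expLaw β (w j)) ∗ expLaw β (w k) := by
  have := isProbabilityMeasure_gammaMeasure hα hβ
  have := isProbabilityMeasure_gammaMeasure one_pos hβ
  have := isProbabilityMeasure_expLaw hβ (w j)
  have := isProbabilityMeasure_expLaw hβ (w k)
  have : IsProbabilityMeasure (law α β w) := isProbabilityMeasure_genLaw (fun _ => hα) hβ w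
  refine Measure.ext_of_lintegral _ fun ξ hξ => ?_
  rw [Measure.lintegral_conv hξ, Measure.lintegral_conv (by fun_prop), law, lawAdd]
  rw [lintegral_map hξ (by fun_prop), lintegral_map (by fun_prop) (by fun_prop),
    lintegral_prod _ (by fun_prop)]
  refine lintegral_congr fun x => ?_
  rw [expLaw, lintegral_map (by fun_prop) (by fun_prop), lintegral_prod _ (by fun_prop)]
  refine lintegral_congr fun y => ?_
  rw [expLaw, lintegral_map (by fun_prop) (by fun_prop)]

lemma lawAdd_eq_genLaw {α β : ℝ} (hα : 0 < α) (hβ : 0 < β) {n : ℕ} (w : Fin n → ℝ)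
    (j k : Fin n) :
    lawAdd α β w j k =
      genLaw (Fin.cons 1 (Fin.cons 1 fun _ => α : Fin (n + 1) → ℝ) : Fin (n + 1 + 1) → ℝ) β
        (Fin.cons (w k) (Fin.cons (w j) w : Fin (n + 1) → ℝ) : Fin (n + 1 + 1) → ℝ) := by
  rw [genLaw_cons (Fin.cases one_pos fun _ => hα) one_pos hβ,
    genLaw_cons (fun _ => hα) one_pos hβ, lawAdd_eq_conv hα hβ]
  rfl

/-- The size-biased gamma law. -/
lemma gammaMeasure_withDensity_id {a β : ℝ} (ha : 0 < a) (hβ : 0 < β) :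
    (gammaMeasure a β).withDensity (fun x => ENNReal.ofReal x) =
      ENNReal.ofReal (a / β) • (gammaMeasure a β ∗ gammaMeasure 1 β) := by
  have hm : ∀ a, Measurable (gammaPDF a β) := fun a => (measurable_gammaPDFReal a β).ennreal_ofReal
  rw [gammaMeasure, gammaMeasure, conv_withDensity_eq_lconvolution (hm a) (hm 1),
    ← withDensity_mul _ (hm a) (by fun_prop), ← withDensity_smul _ (by fun_prop)]
  congr 1; ext z
  simp only [Pi.mul_apply, Pi.smul_apply, smul_eq_mul, lconvolution_def]
  rcases le_or_gt z 0 with hz | hz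
  · rw [ENNReal.ofReal_of_nonpos hz, mul_zero, eq_comm, mul_eq_zero]
    right
    rw [lintegral_eq_zero_iff (by fun_prop)]
    have h0 : ∀ᵐ y : ℝ, y ≠ 0 := by simp [ae_iff]
    filter_upwards [h0] with y hy
    rcases lt_or_gt_of_ne hy with h | h
    · simp [gammaPDF_of_neg h]
    · simp [gammaPDF_of_neg (show -y + z < 0 by linarith)]
  · set C := β ^ a / Gamma a with hC
    have hCpos : 0 < C := by positivity
    have h1 : ∀ y, gammaPDF a β y * gammaPDF 1 β (-y + z) =
        ENNReal.ofReal (C * β * exp (-(β * z))) *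
          (Icc 0 z).indicator (fun y => ENNReal.ofReal (y ^ (a - 1))) y := fun y => by
      by_cases hy : y ∈ Icc 0 z
      · rw [indicator_of_mem hy, gammaPDF_of_nonneg hy.1,
          gammaPDF_of_nonneg (show 0 ≤ -y + z by linarith [hy.2]), ← ENNReal.ofReal_mul,
          ← ENNReal.ofReal_mul (by positivity)]
        · congr 1
          have : exp (-(β * z)) = exp (-(β * y)) * exp (-(β * (-y + z))) := by
            rw [← exp_add]; ring_nf
          rw [this]
          simp
          ring
        · have := rpow_nonneg hy.1 (a - 1)
          positivity
      · rw [indicator_of_notMem hy, mul_zero]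
        rw [mem_Icc, not_and_or, not_le, not_le] at hy
        rcases hy with h | h
        · simp [gammaPDF_of_neg h]
        · simp [gammaPDF_of_neg (show -y + z < 0 by linarith)]
    simp_rw [h1]
    rw [lintegral_const_mul _ (Measurable.indicator (by fun_prop) measurableSet_Icc),
      lintegral_indicator measurableSet_Icc]
    have h2 : ∫⁻ y in Icc 0 z, ENNReal.ofReal (y ^ (a - 1)) = ENNReal.ofReal (z ^ a / a) := by
      have hInt : IntegrableOn (fun y : ℝ => y ^ (a - 1)) (Icc 0 z) := by
        rw [integrableOn_Icc_iff_integrableOn_Ioc,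
          ← intervalIntegrable_iff_integrableOn_Ioc_of_le hz.le]
        exact intervalIntegral.intervalIntegrable_rpow' (by linarith)
      rw [← ofReal_integral_eq_lintegral_ofReal hInt]
      · rw [integral_Icc_eq_integral_Ioc, ← intervalIntegral.integral_of_le hz.le,
          integral_rpow (Or.inl (by linarith))]
        simp [zero_rpow ha.ne']
      · exact (ae_restrict_iff' measurableSet_Icc).2 (ae_of_all _ fun y hy => rpow_nonneg hy.1 _)
    rw [h2, gammaPDF_of_nonneg hz.le, ← ENNReal.ofReal_mul (by positivity),
      ← ENNReal.ofReal_mul (by positivity), ← ENNReal.ofReal_mul (by positivity)]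
    congr 1
    have : z ^ a = z ^ (a - 1) * z := by
      rw [← rpow_add_one hz.ne']; simp
    rw [this, ← hC]
    field_simp

/-- Splitting off one coordinate of a linear combination of independent variables. -/
lemma lintegral_pi_split {n : ℕ} {μ : Fin (n + 1) → Measure ℝ} [∀ i, IsProbabilityMeasure (μ i)]
    (w : Fin (n + 1) → ℝ) (i : Fin (n + 1)) {F : ℝ → ℝ → ENNReal}
    (hF : Measurable (Function.uncurry F)) :
    ∫⁻ x, F (x i) (∑ j, w j * x j) ∂(Measure.pi μ) =
      ∫⁻ x', ∫⁻ y, F y (w i * y + ∑ j, w (i.succAbove j) * x' j) ∂(μ i)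
        ∂(Measure.pi fun j => μ (i.succAbove j)) := by
  have h := measurePreserving_piFinSuccAbove μ i
  rw [← lintegral_prod_symm' (fun p : ℝ × (Fin n → ℝ) =>
    F p.1 (w i * p.1 + ∑ j, w (i.succAbove j) * p.2 j)), ← h.lintegral_comp]
  · refine lintegral_congr fun x => ?_
    rw [Fin.sum_univ_succAbove _ i]
    rfl
  · exact hF.comp (f := fun p : ℝ × (Fin n → ℝ) =>
      (p.1, w i * p.1 + ∑ j, w (i.succAbove j) * p.2 j)) (by fun_prop)
  · exact hF.comp (f := fun p : ℝ × (Fin n → ℝ) =>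
      (p.1, w i * p.1 + ∑ j, w (i.succAbove j) * p.2 j)) (by fun_prop)

/-- Size-biasing by the `i`-th variable adds an independent exponential variable. -/
lemma map_withDensity_eval {n : ℕ} {κ : Fin n → ℝ} {β : ℝ} (hκ : ∀ i, 0 < κ i)
    (hβ : 0 < β) (w : Fin n → ℝ) (i : Fin n) :
    ((Measure.pi fun i => gammaMeasure (κ i) β).withDensity
        (fun x => ENNReal.ofReal (x i))).map (fun x => ∑ i, w i * x i) =
      ENNReal.ofReal (κ i / β) • (genLaw κ β w ∗ expLaw β (w i)) := by
  obtain _ | n := n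
  · exact i.elim0
  have := fun i => isProbabilityMeasure_gammaMeasure (hκ i) hβ
  have := isProbabilityMeasure_gammaMeasure one_pos hβ
  have := isProbabilityMeasure_expLaw hβ (w i)
  refine Measure.ext_of_lintegral _ fun ξ hξ => ?_
  rw [lintegral_map hξ (by fun_prop), lintegral_smul_measure, Measure.lintegral_conv hξ, genLaw,
    lintegral_map (by fun_prop) (by fun_prop),
    lintegral_withDensity_eq_lintegral_mul _ (by fun_prop) (by fun_prop)]
  simp only [Pi.mul_apply]
  rw [lintegral_pi_split w i (F := fun y s => ENNReal.ofReal y * ξ s)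
    (by unfold Function.uncurry; fun_prop),
    lintegral_pi_split w i (F := fun _ s => ∫⁻ y, ξ (s + y) ∂expLaw β (w i))
    (by unfold Function.uncurry; fun_prop), smul_eq_mul, ← lintegral_const_mul _ (by fun_prop)]
  refine lintegral_congr fun x' => ?_
  set r := ∑ j, w (i.succAbove j) * x' j
  have h1 : ∫⁻ y, ENNReal.ofReal y * ξ (w i * y + r) ∂gammaMeasure (κ i) β =
      ∫⁻ y, ξ (w i * y + r) ∂(gammaMeasure (κ i) β).withDensity (fun x => ENNReal.ofReal x) := by
    rw [lintegral_withDensity_eq_lintegral_mul _ (by fun_prop) (by fun_prop)]; rfl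
  rw [h1, gammaMeasure_withDensity_id (hκ i) hβ, lintegral_smul_measure,
    Measure.lintegral_conv (by fun_prop), smul_eq_mul]
  congr 1
  refine lintegral_congr fun y => ?_
  rw [expLaw, lintegral_map (by fun_prop) (by fun_prop)]
  refine lintegral_congr fun z => ?_
  congr 1; ring

lemma ae_gammaMeasure_pos (a β : ℝ) : ∀ᵐ x ∂gammaMeasure a β, 0 < x := by
  have hm : Measurable (gammaPDF a β) := (measurable_gammaPDFReal a β).ennreal_ofReal
  rw [gammaMeasure, ae_withDensity_iff hm]
  have h0 : ∀ᵐ y : ℝ, y ≠ 0 := by simp [ae_iff]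
  filter_upwards [h0] with y hy hp
  refine lt_of_le_of_ne ?_ hy.symm
  by_contra! h
  exact hp (gammaPDF_of_neg h)

lemma ae_pi_gammaMeasure_pos {n : ℕ} {κ : Fin n → ℝ} {β : ℝ} (hκ : ∀ i, 0 < κ i) (hβ : 0 < β) :
    ∀ᵐ x ∂(Measure.pi fun i => gammaMeasure (κ i) β), ∀ i, 0 < x i := by
  have := fun i => isProbabilityMeasure_gammaMeasure (hκ i) hβ
  rw [ae_all_iff]
  exact fun i =>
    (measurePreserving_eval (fun i => gammaMeasure (κ i) β) i).quasiMeasurePreserving.ae (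
      ae_gammaMeasure_pos (κ i) β)

lemma ae_genLaw_nonneg {n : ℕ} {κ : Fin n → ℝ} {β : ℝ} (hκ : ∀ i, 0 < κ i) (hβ : 0 < β)
    {w : Fin n → ℝ} (hw : ∀ i, 0 ≤ w i) : ∀ᵐ x ∂genLaw κ β w, 0 ≤ x := by
  rw [genLaw, ae_map_iff (measurable_weightedSum w).aemeasurable measurableSet_Ici]
  filter_upwards [ae_pi_gammaMeasure_pos hκ hβ] with x hx
  exact Finset.sum_nonneg fun i _ => mul_nonneg (hw i) (hx i).le

lemma ae_genLaw_pos {n : ℕ} {κ : Fin n → ℝ} {β : ℝ} (hκ : ∀ i, 0 < κ i) (hβ : 0 < β)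
    {w : Fin n → ℝ} (hw : ∀ i, 0 ≤ w i) {i : Fin n} (hi : 0 < w i) :
    ∀ᵐ x ∂genLaw κ β w, 0 < x := by
  rw [genLaw, ae_map_iff (measurable_weightedSum w).aemeasurable measurableSet_Ioi]
  filter_upwards [ae_pi_gammaMeasure_pos hκ hβ] with x hx
  exact Finset.sum_pos' (fun i _ => mul_nonneg (hw i) (hx i).le)
    ⟨i, Finset.mem_univ i, mul_pos hi (hx i)⟩

/-- The size-biased law of a linear combination of independent gamma variables. -/
lemma genLaw_withDensity_id {n : ℕ} {κ : Fin n → ℝ} {β : ℝ} (hκ : ∀ i, 0 < κ i) (hβ : 0 < β)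
    {w : Fin n → ℝ} (hw : ∀ i, 0 ≤ w i) :
    (genLaw κ β w).withDensity (fun x => ENNReal.ofReal x) =
      ∑ i, ENNReal.ofReal (w i * κ i / β) • (genLaw κ β w ∗ expLaw β (w i)) := by
  refine Measure.ext_of_lintegral _ fun ξ hξ => ?_
  have h1 : ∀ i, ENNReal.ofReal (w i * κ i / β) • (genLaw κ β w ∗ expLaw β (w i)) =
      ENNReal.ofReal (w i) • ((Measure.pi fun i => gammaMeasure (κ i) β).withDensity
        (fun x => ENNReal.ofReal (x i))).map (fun x => ∑ i, w i * x i) := fun i => by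
    rw [map_withDensity_eval hκ hβ w i, smul_smul, ← ENNReal.ofReal_mul (hw i), mul_div_assoc]
  rw [Finset.sum_congr rfl fun i _ => h1 i, lintegral_finsetSum_measure,
    lintegral_withDensity_eq_lintegral_mul _ (by fun_prop) hξ]
  have h2 : ∀ i, ∫⁻ a, ξ a ∂(ENNReal.ofReal (w i) • ((Measure.pi fun i =>
        gammaMeasure (κ i) β).withDensity (fun x => ENNReal.ofReal (x i))).map
          (fun x => ∑ i, w i * x i)) =
      ∫⁻ x, ENNReal.ofReal (w i) * (ENNReal.ofReal (x i) * ξ (∑ i, w i * x i))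
        ∂(Measure.pi fun i => gammaMeasure (κ i) β) := fun i => by
    rw [lintegral_smul_measure, lintegral_map hξ (by fun_prop),
      lintegral_withDensity_eq_lintegral_mul _ (by fun_prop) (by fun_prop), smul_eq_mul,
      ← lintegral_const_mul _ (by fun_prop)]
    rfl
  rw [Finset.sum_congr rfl fun i _ => h2 i, ← lintegral_finsetSum _ (by fun_prop), genLaw,
    lintegral_map (by fun_prop) (by fun_prop)]
  refine lintegral_congr_ae ?_
  filter_upwards [ae_pi_gammaMeasure_pos hκ hβ] with x hx
  rw [Pi.mul_apply, ENNReal.ofReal_sum_of_nonneg fun i _ => mul_nonneg (hw i) (hx i).le,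
    Finset.sum_mul]
  refine Finset.sum_congr rfl fun i _ => ?_
  rw [ENNReal.ofReal_mul (hw i), mul_assoc]

lemma lintegral_genLaw_id {n : ℕ} {κ : Fin n → ℝ} {β : ℝ} (hκ : ∀ i, 0 < κ i) (hβ : 0 < β)
    {w : Fin n → ℝ} (hw : ∀ i, 0 ≤ w i) :
    ∫⁻ x, ENNReal.ofReal x ∂genLaw κ β w = ENNReal.ofReal (∑ i, w i * κ i / β) := by
  have h := congrArg (fun μ : Measure ℝ => μ univ) (genLaw_withDensity_id hκ hβ hw)
  have := isProbabilityMeasure_genLaw hκ hβ w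
  have := fun i => isProbabilityMeasure_expLaw hβ (w i)
  simp only [withDensity_apply _ MeasurableSet.univ, Measure.restrict_univ] at h
  rw [h, Measure.finsetSum_apply, ENNReal.ofReal_sum_of_nonneg fun i _ =>
    div_nonneg (mul_nonneg (hw i) (hκ i).le) hβ.le]
  simp

/-- The kernel `κ * exp (-(b * y))` on the nonnegative half-line. -/
noncomputable def expKernel (κ b y : ℝ) : ℝ := if 0 ≤ y then κ * exp (-(b * y)) else 0

@[fun_prop]
lemma measurable_expKernel (κ b : ℝ) : Measurable (expKernel κ b) :=
  Measurable.ite measurableSet_Ici (by fun_prop) measurable_const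

lemma expKernel_nonneg {κ : ℝ} (hκ : 0 ≤ κ) (b y : ℝ) : 0 ≤ expKernel κ b y := by
  unfold expKernel
  split_ifs <;> positivity

lemma expKernel_le {κ b : ℝ} (hκ : 0 ≤ κ) (hb : 0 ≤ b) (y : ℝ) : expKernel κ b y ≤ κ := by
  unfold expKernel
  split_ifs with h
  · refine mul_le_of_le_one_right hκ (exp_le_one_iff.2 ?_)
    have := mul_nonneg hb h
    linarith
  · exact hκ

lemma expLaw_eq_withDensity {β c κ : ℝ} (hβ : 0 < β) (hc : 0 < c) (hκ : 0 ≤ κ) :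
    ENNReal.ofReal (c * κ / β) • expLaw β c =
      volume.withDensity (fun y => ENNReal.ofReal (expKernel κ (β / c) y)) := by
  have hm : Measurable (gammaPDF 1 β) := (measurable_gammaPDFReal 1 β).ennreal_ofReal
  refine Measure.ext_of_lintegral _ fun ξ hξ => ?_
  rw [lintegral_smul_measure, expLaw, lintegral_map hξ (by fun_prop), gammaMeasure,
    lintegral_withDensity_eq_lintegral_mul _ hm (by fun_prop),
    lintegral_withDensity_eq_lintegral_mul _ (by fun_prop) hξ]
  have hvol := Real.smul_map_volume_mul_left hc.ne'
  nth_rw 2 [← hvol]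
  rw [lintegral_smul_measure, lintegral_map (by fun_prop) (by fun_prop), smul_eq_mul, smul_eq_mul,
    ← lintegral_const_mul _ (by fun_prop), ← lintegral_const_mul _ (by fun_prop)]
  refine lintegral_congr fun y => ?_
  simp only [Pi.mul_apply]
  rw [← mul_assoc, ← mul_assoc, gammaPDF, ← ENNReal.ofReal_mul (by positivity),
    ← ENNReal.ofReal_mul (abs_nonneg c)]
  congr 2
  rw [gammaPDFReal, expKernel, abs_of_pos hc]
  by_cases hy : 0 ≤ y
  · rw [if_pos hy, if_pos (by positivity)]
    have : β / c * (c * y) = β * y := by field_simp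
    rw [this]
    simp
    field_simp
  · have : ¬ 0 ≤ c * y := by
      rw [not_le] at hy ⊢
      exact mul_neg_of_pos_of_neg hc hy
    rw [if_neg hy, if_neg this]
    simp

lemma lintegral_conv_withDensity (P : Measure ℝ) [SFinite P] {k ξ : ℝ → ENNReal}
    (hk : Measurable k) (hξ : Measurable ξ) :
    ∫⁻ z, ξ z ∂(P ∗ volume.withDensity k) = ∫⁻ z, (∫⁻ x, k (z - x) ∂P) * ξ z := by
  have h1 : ∀ x, ∫⁻ y, ξ (x + y) ∂(volume.withDensity k) = ∫⁻ z, k (z - x) * ξ z := fun x => by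
    rw [lintegral_withDensity_eq_lintegral_mul _ hk (by fun_prop),
      ← lintegral_sub_right_eq_self _ x]
    refine lintegral_congr fun z => ?_
    simp
  rw [Measure.lintegral_conv hξ]
  simp_rw [h1]
  rw [lintegral_lintegral_swap (by unfold Function.uncurry; fun_prop)]
  refine lintegral_congr fun z => ?_
  rw [lintegral_mul_const _ (by fun_prop)]

lemma lintegral_mul_genLaw {n : ℕ} {κ : Fin n → ℝ} {β : ℝ} (hκ : ∀ i, 0 < κ i)
    (hβ : 0 < β) {w : Fin n → ℝ} (hw : ∀ i, 0 ≤ w i) {ξ : ℝ → ENNReal} (hξ : Measurable ξ) :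
    ∫⁻ x, ENNReal.ofReal x * ξ x ∂genLaw κ β w =
      ∫⁻ z, (∑ i : {i // 0 < w i},
        ∫⁻ x, ENNReal.ofReal (expKernel (κ i) (β / w i) (z - x)) ∂genLaw κ β w) * ξ z := by
  have := isProbabilityMeasure_genLaw hκ hβ w
  have := fun i => isProbabilityMeasure_expLaw hβ (w i)
  have h1 : ∫⁻ x, ENNReal.ofReal x * ξ x ∂genLaw κ β w =
      ∫⁻ x, ξ x ∂(genLaw κ β w).withDensity (fun x => ENNReal.ofReal x) := by
    rw [lintegral_withDensity_eq_lintegral_mul _ (by fun_prop) hξ]; rfl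
  have h2 : ∀ i : {i // 0 < w i},
      ∫⁻ x, ξ x ∂(ENNReal.ofReal (w i * κ i / β) • (genLaw κ β w ∗ expLaw β (w i))) =
        ∫⁻ z, (∫⁻ x, ENNReal.ofReal (expKernel (κ i) (β / w i) (z - x)) ∂genLaw κ β w) * ξ z :=
    fun i => by
      rw [← lintegral_conv_withDensity _
          (k := fun y => ENNReal.ofReal (expKernel (κ i) (β / w i) y)) (by fun_prop) hξ,
        ← expLaw_eq_withDensity hβ i.2 (hκ i).le, lintegral_smul_measure,
        Measure.lintegral_conv hξ, Measure.lintegral_conv hξ, smul_eq_mul,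
        ← lintegral_const_mul _ (by fun_prop)]
      simp_rw [lintegral_smul_measure, smul_eq_mul]
  rw [h1, genLaw_withDensity_id hκ hβ hw, lintegral_finsetSum_measure]
  simp_rw [Finset.sum_mul]
  rw [lintegral_finsetSum _ (fun i _ => by fun_prop), ← Finset.sum_congr rfl fun i _ => h2 i]
  rw [← Finset.sum_filter_of_ne (p := fun i => 0 < w i)]
  · exact Finset.sum_subtype _ (by simp) _
  · intro i _ hi
    refine lt_of_le_of_ne (hw i) fun h0 => hi ?_
    simp [← h0]

/-- A nontrivial nonnegative combination of independent gamma variables has a density that solves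
a renewal equation. -/
theorem exists_density_genLaw {n : ℕ} {κ : Fin n → ℝ} {β : ℝ} (hκ : ∀ i, 0 < κ i)
    (hβ : 0 < β) {w : Fin n → ℝ} (hw : ∀ i, 0 ≤ w i) {i₀ : Fin n} (hi₀ : 0 < w i₀) :
    ∃ f : ℝ → ℝ, Measurable f ∧ (∀ x ≤ 0, f x = 0) ∧
      genLaw κ β w = volume.withDensity (fun x => ENNReal.ofReal (f x)) ∧
      ExpRenewal (fun i : {i // 0 < w i} => κ i) (fun i => β / w i) f := by
  have := isProbabilityMeasure_genLaw hκ hβ w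
  set P := genLaw κ β w with hP
  set q : ℝ → ENNReal := fun z => ∑ i : {i // 0 < w i},
    ∫⁻ x, ENNReal.ofReal (expKernel (κ i) (β / w i) (z - x)) ∂P with hq
  have hqm : Measurable q := Finset.measurable_fun_sum _ fun i _ => by fun_prop
  have hqtop' : ∀ z (i : {i // 0 < w i}),
      ∫⁻ x, ENNReal.ofReal (expKernel (κ i) (β / w i) (z - x)) ∂P ≠ ⊤ := fun z i => by
    refine ne_top_of_le_ne_top (b := ENNReal.ofReal (κ i)) ENNReal.ofReal_ne_top ?_
    refine (lintegral_mono fun x => ENNReal.ofReal_le_ofReal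
      (expKernel_le (hκ i).le (div_pos hβ i.2).le (z - x))).trans ?_
    simp
  have hqtop : ∀ z, q z ≠ ⊤ := fun z => by
    simp only [hq, ne_eq, ENNReal.sum_eq_top, not_exists, not_and]
    exact fun i _ => hqtop' z i
  set f : ℝ → ℝ := fun z => if 0 < z then (q z).toReal / z else 0 with hf
  have hfm : Measurable f :=
    Measurable.ite measurableSet_Ioi (hqm.ennreal_toReal.div measurable_id) measurable_const
  have hf0 : ∀ x ≤ 0, f x = 0 := fun x hx => if_neg hx.not_gt
  have hfnn : ∀ x, 0 ≤ f x := fun x => by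
    simp only [hf]
    split_ifs with h
    · exact div_nonneg ENNReal.toReal_nonneg h.le
    · exact le_rfl
  have hPf : P = volume.withDensity (fun x => ENNReal.ofReal (f x)) := by
    refine Measure.ext_of_lintegral _ fun ξ hξ => ?_
    rw [lintegral_withDensity_eq_lintegral_mul _ (by fun_prop) hξ]
    have h1 : ∫⁻ x, ξ x ∂P = ∫⁻ x, ENNReal.ofReal x * (ENNReal.ofReal x⁻¹ * ξ x) ∂P := by
      refine lintegral_congr_ae ?_
      filter_upwards [ae_genLaw_pos hκ hβ hw hi₀] with x hx
      rw [← mul_assoc, ← ENNReal.ofReal_mul hx.le, mul_inv_cancel₀ hx.ne', ENNReal.ofReal_one,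
        one_mul]
    rw [h1, lintegral_mul_genLaw hκ hβ hw (by fun_prop)]
    refine lintegral_congr fun z => ?_
    rw [Pi.mul_apply, ← mul_assoc]
    congr 1
    change q z * _ = _
    rcases le_or_gt z 0 with hz | hz
    · rw [hf0 z hz, ENNReal.ofReal_of_nonpos (inv_nonpos.2 hz)]
      simp
    · simp only [hf, if_pos hz]
      rw [div_eq_mul_inv, ENNReal.ofReal_mul ENNReal.toReal_nonneg,
        ENNReal.ofReal_toReal (hqtop z)]
  have hl1 : ∫⁻ x, ENNReal.ofReal (f x) = 1 := by
    have : P univ = 1 := measure_univ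
    rw [hPf, withDensity_apply _ MeasurableSet.univ, Measure.restrict_univ] at this
    exact this
  have hfi : Integrable f := by
    rw [← lintegral_ofReal_ne_top_iff_integrable hfm.aestronglyMeasurable (ae_of_all _ hfnn), hl1]
    exact ENNReal.one_ne_top
  refine ⟨f, hfm, hf0, hPf, fun i => hκ i, fun i => div_pos hβ i.2, hfnn, hfi, ?_, fun z hz => ?_⟩
  · rw [setIntegral_eq_integral_of_forall_compl_eq_zero (s := Ioi 0)
      (fun x hx => hf0 x (not_lt.1 hx)),
      integral_eq_lintegral_of_nonneg_ae (ae_of_all _ hfnn) hfm.aestronglyMeasurable, hl1]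
    simp
  · have h1 : z * f z = (q z).toReal := by
      simp only [hf, if_pos hz]
      field_simp
    rw [h1, hq, ENNReal.toReal_sum fun i _ => hqtop' z i]
    refine Finset.sum_congr rfl fun i _ => ?_
    rw [hPf, lintegral_withDensity_eq_lintegral_mul _ (by fun_prop) (by fun_prop)]
    simp only [Pi.mul_apply]
    simp_rw [← ENNReal.ofReal_mul (hfnn _)]
    rw [← integral_eq_lintegral_of_nonneg_ae
      (ae_of_all _ fun x => mul_nonneg (hfnn x) (expKernel_nonneg (hκ i).le _ _))
      (Measurable.aestronglyMeasurable (by fun_prop)),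
      ← intervalIntegral.integral_const_mul, intervalIntegral.integral_of_le hz.le,
      ← setIntegral_eq_integral_of_forall_compl_eq_zero (s := Ioc 0 z)]
    · refine setIntegral_congr_fun measurableSet_Ioc fun x hx => ?_
      simp only [expKernel]
      rw [if_pos (by linarith [hx.2])]
      ring
    · intro x hx
      rw [mem_Ioc, not_and_or, not_lt, not_le] at hx
      rcases hx with h | h
      · rw [hf0 x h, zero_mul]
      · rw [expKernel, if_neg (by linarith), mul_zero]

/-- Nonnegative combinations of independent gamma variables of total shape larger than one are
unimodal. -/
theorem exists_isMode_genLaw {n : ℕ} {κ : Fin n → ℝ} {β : ℝ} (hκ : ∀ i, 0 < κ i)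
    (hβ : 0 < β) {w : Fin n → ℝ} (hw : ∀ i, 0 ≤ w i)
    (h1 : 1 < ∑ i : {i // 0 < w i}, κ i) : ∃ x, IsMode (genLaw κ β w) x := by
  obtain ⟨i₀⟩ := ExpRenewal.nonempty_of_one_lt_sum h1
  obtain ⟨f, hfm, hf0, hP, hf⟩ := exists_density_genLaw hκ hβ hw i₀.2
  obtain ⟨a, ha, hmono, hanti⟩ := hf.exists_mode h1
  refine ⟨a, fun x => ENNReal.ofReal (f x), hfm.ennreal_ofReal, hP, ?_, ?_⟩
  · intro x hx y hy hxy
    refine ENNReal.ofReal_le_ofReal ?_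
    rcases le_or_gt x 0 with h | h
    · rw [hf0 x h]
      exact hf.nonneg y
    · exact hmono ⟨h, le_of_lt hx⟩ ⟨h.trans_le hxy, le_of_lt hy⟩ hxy
  · intro x hx y hy hxy
    exact ENNReal.ofReal_le_ofReal (hanti (mem_Ici.2 (le_of_lt hx)) (mem_Ici.2 (le_of_lt hy)) hxy)

theorem exists_isMode_lawAdd {α β : ℝ} (hα : 0 < α) (hβ : 0 < β) {n : ℕ} {w : Fin n → ℝ}
    (hw : ∀ i, 0 ≤ w i) {j k : Fin n} (hj : 0 < w j) : ∃ x, IsMode (lawAdd α β w j k) x := by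
  rw [lawAdd_eq_genLaw hα hβ]
  refine exists_isMode_genLaw (Fin.cases one_pos (Fin.cases one_pos fun _ => hα)) hβ
    (Fin.cases (hw k) (Fin.cases (hw j) hw)) ?_
  set W : Fin (n + 1 + 1) → ℝ := Fin.cons (w k) (Fin.cons (w j) w : Fin (n + 1) → ℝ) with hW
  set K : Fin (n + 1 + 1) → ℝ := Fin.cons 1 (Fin.cons 1 fun _ => α : Fin (n + 1) → ℝ) with hK
  have hKpos : ∀ i, 0 < K i := Fin.cases one_pos (Fin.cases one_pos fun _ => hα)
  have hsum : ∑ i : {i // 0 < W i}, K i = ∑ i with 0 < W i, K i :=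
    (Finset.sum_subtype _ (by simp) _).symm
  have hne : Fin.succ 0 ≠ Fin.succ (Fin.succ j) := fun h =>
    (Fin.succ_ne_zero j) (Fin.succ_injective _ h).symm
  have hsub : ({Fin.succ 0, Fin.succ (Fin.succ j)} : Finset (Fin (n + 1 + 1))) ⊆
      Finset.univ.filter (fun i => 0 < W i) := by
    intro i hi
    simp only [Finset.mem_insert, Finset.mem_singleton] at hi
    rcases hi with rfl | rfl <;> simp [hW, hj]
  have := Finset.sum_le_sum_of_subset_of_nonneg (f := K) hsub fun i _ _ => (hKpos i).le
  rw [Finset.sum_pair hne] at this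
  have h2 : K (Fin.succ 0) = 1 := by simp [hK]
  have h3 : K (Fin.succ (Fin.succ j)) = α := by simp [hK]
  rw [hsum]
  linarith

lemma law_singleton {α β : ℝ} (hα : 0 < α) (hβ : 0 < β) {n : ℕ} {w : Fin n → ℝ}
    (hw : ∀ i, 0 ≤ w i) {i : Fin n} (hi : 0 < w i) (x : ℝ) : law α β w {x} = 0 := by
  obtain ⟨f, -, -, hP, -⟩ := exists_density_genLaw (fun _ => hα) hβ hw hi
  rw [law_eq_genLaw, hP]
  exact withDensity_absolutelyContinuous _ _ (by simp)

lemma ae_lawAdd_nonneg {α β : ℝ} (hα : 0 < α) (hβ : 0 < β) {n : ℕ} {w : Fin n → ℝ}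
    (hw : ∀ i, 0 ≤ w i) (j k : Fin n) : ∀ᵐ x ∂lawAdd α β w j k, 0 ≤ x := by
  rw [lawAdd_eq_genLaw hα hβ]
  exact ae_genLaw_nonneg (Fin.cases one_pos (Fin.cases one_pos fun _ => hα)) hβ
    (Fin.cases (hw k) (Fin.cases (hw j) hw))

lemma isProbabilityMeasure_lawAdd {α β : ℝ} (hα : 0 < α) (hβ : 0 < β) {n : ℕ} (w : Fin n → ℝ)
    (j k : Fin n) : IsProbabilityMeasure (lawAdd α β w j k) := by
  rw [lawAdd_eq_genLaw hα hβ]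
  exact isProbabilityMeasure_genLaw (Fin.cases one_pos (Fin.cases one_pos fun _ => hα)) hβ _

lemma lintegral_lawAdd_id {α β : ℝ} (hα : 0 < α) (hβ : 0 < β) {n : ℕ} {w : Fin n → ℝ}
    (hw : ∀ i, 0 ≤ w i) (j k : Fin n) :
    ∫⁻ x, ENNReal.ofReal x ∂lawAdd α β w j k =
      ENNReal.ofReal (w k / β + (w j / β + ∑ i, w i * α / β)) := by
  rw [lawAdd_eq_genLaw hα hβ, lintegral_genLaw_id
    (Fin.cases one_pos (Fin.cases one_pos fun _ => hα)) hβ (Fin.cases (hw k) (Fin.cases (hw j) hw))]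
  simp [Fin.sum_univ_succ]

lemma integral_law_id {α β : ℝ} (hα : 0 < α) (hβ : 0 < β) {n : ℕ} {w : Fin n → ℝ}
    (hw : ∀ i, 0 ≤ w i) : ∫ x, x ∂law α β w = ∑ i, w i * α / β := by
  rw [law_eq_genLaw, integral_eq_lintegral_of_nonneg_ae (ae_genLaw_nonneg (fun _ => hα) hβ hw)
    (by fun_prop), lintegral_genLaw_id (fun _ => hα) hβ hw, ENNReal.toReal_ofReal]
  exact Finset.sum_nonneg fun i _ => div_nonneg (mul_nonneg (hw i) hα.le) hβ.le

lemma memQrel_iff {m α β : ℝ} (hm : 0 < m) (hα : 0 < α) (hβ : 0 < β) {n : ℕ} {w : Fin n → ℝ} :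
    MemQrel m α β w ↔ (∀ i, 0 ≤ w i) ∧ (∀ i, w i ≤ β / m) ∧ ∑ i, w i = β / α := by
  have hmean : ∑ i, w i * α / β = 1 ↔ ∑ i, w i = β / α := by
    rw [← Finset.sum_div, ← Finset.sum_mul]
    field_simp
  constructor
  · rintro ⟨h1, h2, h3⟩
    rw [integral_law_id hα hβ h1, hmean] at h3
    refine ⟨h1, fun i => ?_, h3⟩
    rw [scale, div_le_div_iff₀ hβ hm, one_mul] at h2
    rw [le_div_iff₀ hm]
    refine le_trans (mul_le_mul_of_nonneg_right ?_ hm.le) h2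
    exact (le_abs_self _).trans (le_ciSup (f := fun i => |w i|) (Set.finite_range _).bddAbove i)
  · rintro ⟨h1, h2, h3⟩
    refine ⟨h1, ?_, by rw [integral_law_id hα hβ h1, hmean, h3]⟩
    rw [scale, div_le_div_iff₀ hβ hm, one_mul, ← le_div_iff₀ hm]
    exact Real.iSup_le (fun i => by rw [abs_of_nonneg (h1 i)]; exact h2 i) (by positivity)

lemma IsMode.lintegral_le_lintegral_shift {P : Measure ℝ} {x d : ℝ} (h : IsMode P x) (hd : 0 < d)
    {ρ : ℝ → ENNReal} (hρ : Measurable ρ) (h0 : ∀ y, x - d ≤ y → ρ y = 0) :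
    ∫⁻ y, ρ y ∂P ≤ ∫⁻ y, ρ (y - d) ∂P := by
  obtain ⟨f, hf, rfl, hmono, -⟩ := h
  rw [lintegral_withDensity_eq_lintegral_mul _ hf hρ,
    lintegral_withDensity_eq_lintegral_mul _ hf (by fun_prop),
    ← lintegral_add_right_eq_self (fun y => (f * fun y => ρ (y - d)) y) d]
  refine lintegral_mono fun y => ?_
  simp only [Pi.mul_apply, add_sub_cancel_right]
  rcases lt_or_ge y (x - d) with hy | hy
  · gcongr
    exact hmono (mem_Iio.2 (by linarith)) (mem_Iio.2 (by linarith)) (by linarith)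
  · simp [h0 y hy]

lemma IsMode.lintegral_shift_le_lintegral {P : Measure ℝ} {x d : ℝ} (h : IsMode P x) (hd : 0 < d)
    {ρ : ℝ → ENNReal} (hρ : Measurable ρ) (h0 : ∀ y, y ≤ x → ρ y = 0) :
    ∫⁻ y, ρ (y - d) ∂P ≤ ∫⁻ y, ρ y ∂P := by
  obtain ⟨f, hf, rfl, -, hanti⟩ := h
  rw [lintegral_withDensity_eq_lintegral_mul _ hf hρ,
    lintegral_withDensity_eq_lintegral_mul _ hf (by fun_prop),
    ← lintegral_add_right_eq_self (fun y => (f * fun y => ρ (y - d)) y) d]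
  refine lintegral_mono fun y => ?_
  simp only [Pi.mul_apply, add_sub_cancel_right]
  rcases lt_or_ge x y with hy | hy
  · gcongr
    exact hanti (mem_Ioi.2 (by linarith)) (mem_Ioi.2 (by linarith)) (by linarith)
  · simp [h0 y hy]

lemma IsMode.nonneg {P : Measure ℝ} [IsProbabilityMeasure P] {x : ℝ} (h : IsMode P x)
    (h0 : ∀ᵐ y ∂P, 0 ≤ y) : 0 ≤ x := by
  by_contra! hx
  obtain ⟨f, hf, hP, -, hanti⟩ := h
  have h1 : P (Ioo x 0) = 0 :=
    measure_mono_null (fun y hy => not_le.2 hy.2) (ae_iff.1 h0)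
  have h2 : P (Ici 0) = 1 := by
    rw [prob_compl_eq_zero_iff measurableSet_Ici |>.symm]
    exact ae_iff.1 h0
  rw [hP, withDensity_apply _ measurableSet_Ioo, lintegral_eq_zero_iff hf] at h1
  have : NeBot (ae (volume.restrict (Ioo x 0))) := by
    rw [ae_neBot, Ne, Measure.restrict_eq_zero]
    simp [hx]
  obtain ⟨y, hy, hyI⟩ := (h1.and (ae_restrict_mem measurableSet_Ioo)).exists
  rw [hP, withDensity_apply _ measurableSet_Ici, setLIntegral_congr_fun measurableSet_Ici
    (g := fun _ => 0)] at h2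
  · simp at h2
  · intro z hz
    have := hanti (mem_Ioi.2 hyI.1) (mem_Ioi.2 (hx.trans_le hz)) (hyI.2.le.trans hz)
    rw [hy] at this
    exact le_antisymm this (zero_le)

lemma IsMode.le_four_mul {P : Measure ℝ} [IsProbabilityMeasure P] {x M : ℝ} (h : IsMode P x)
    (h0 : ∀ᵐ y ∂P, 0 ≤ y) (hM : 0 ≤ M) (hmean : ∫⁻ y, ENNReal.ofReal y ∂P ≤ ENNReal.ofReal M) :
    x ≤ 4 * M := by
  rcases le_or_gt x 0 with hx | hx
  · linarith
  have h1 : P (Ico 0 (x / 2)) ≤ P (Ici (x / 2)) := by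
    have := h.lintegral_le_lintegral_shift (half_pos hx)
      (ρ := (Ico 0 (x / 2)).indicator 1) (measurable_one.indicator measurableSet_Ico)
      (fun y hy => indicator_of_notMem (fun hh => by linarith [hh.2]) _)
    rw [lintegral_indicator_one measurableSet_Ico] at this
    refine this.trans ?_
    rw [← lintegral_indicator_one measurableSet_Ici]
    refine lintegral_mono fun y => ?_
    by_cases hy : y - x / 2 ∈ Ico 0 (x / 2)
    · rw [indicator_of_mem hy, indicator_of_mem (show y ∈ Ici (x / 2) from sub_nonneg.1 hy.1)]
      exact le_rfl
    · rw [indicator_of_notMem hy]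
      exact zero_le
  have h2 : P (Ici 0) = 1 := by
    rw [prob_compl_eq_zero_iff measurableSet_Ici |>.symm]
    exact ae_iff.1 h0
  have h3 : 1 ≤ 2 * P (Ici (x / 2)) := by
    rw [← h2, ← Ico_union_Ici_eq_Ici (half_pos hx).le, two_mul]
    exact (measure_union_le _ _).trans (by gcongr)
  have h4 : ENNReal.ofReal (x / 2) * P (Ici (x / 2)) ≤ ENNReal.ofReal M := by
    refine le_trans ?_ ((mul_meas_ge_le_lintegral (μ := P) ENNReal.measurable_ofReal
      (ENNReal.ofReal (x / 2))).trans hmean)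
    gcongr
    exact fun y hy => ENNReal.ofReal_le_ofReal hy
  have h5 : ENNReal.ofReal (x / 2) ≤ ENNReal.ofReal (2 * M) := by
    calc ENNReal.ofReal (x / 2) = ENNReal.ofReal (x / 2) * 1 := (mul_one _).symm
      _ ≤ ENNReal.ofReal (x / 2) * (2 * P (Ici (x / 2))) := by gcongr
      _ = 2 * (ENNReal.ofReal (x / 2) * P (Ici (x / 2))) := by ring
      _ ≤ 2 * ENNReal.ofReal M := by gcongr
      _ = ENNReal.ofReal (2 * M) := by rw [ENNReal.ofReal_mul two_pos.le]; simp
  rw [ENNReal.ofReal_le_ofReal_iff (by linarith)] at h5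
  linarith

section Modes

variable {m α β : ℝ}

lemma modes_subset_Icc (hα : 0 < α) (hm : 0 < m) (hβ : 0 < β) :
    modes m α β ⊆ Icc 0 (4 * (1 / m + (1 / m + 1))) := by
  rintro x ⟨n, w, j, k, hw, -, hx⟩
  obtain ⟨hw0, hwm, hws⟩ := (memQrel_iff hm hα hβ).1 hw
  have := isProbabilityMeasure_lawAdd hα hβ w j k
  have hle : ∀ i, w i / β ≤ 1 / m := fun i => by
    rw [div_le_iff₀ hβ]
    exact (hwm i).trans_eq (by field_simp)
  refine ⟨hx.nonneg (ae_lawAdd_nonneg hα hβ hw0 j k),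
    hx.le_four_mul (ae_lawAdd_nonneg hα hβ hw0 j k) (by positivity) ?_⟩
  rw [lintegral_lawAdd_id hα hβ hw0]
  refine ENNReal.ofReal_le_ofReal (add_le_add (hle k) (add_le_add (hle j) (le_of_eq ?_)))
  rw [← Finset.sum_div, ← Finset.sum_mul, hws]
  field_simp

lemma modes_nonempty (hα : 0 < α) (hm : 0 < m) (hβ : 0 < β) : (modes m α β).Nonempty := by
  obtain ⟨N, hN⟩ := exists_nat_ge (m / α)
  rw [div_le_iff₀ hα] at hN
  have hN2 : (0 : ℝ) < (N + 2 : ℕ) := by positivity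
  set c := β / (α * (N + 2 : ℕ)) with hc
  have hc0 : 0 < c := by positivity
  have hw : MemQrel m α β (fun _ : Fin (N + 2) => c) := by
    refine (memQrel_iff hm hα hβ).2 ⟨fun _ => hc0.le, fun _ => ?_, ?_⟩
    · refine div_le_div_of_nonneg_left hβ.le hm ?_
      push_cast
      linarith
    · rw [Finset.sum_const, Finset.card_univ, Fintype.card_fin, nsmul_eq_mul, hc]
      field_simp
  obtain ⟨x, hx⟩ := exists_isMode_lawAdd hα hβ hw.nonneg (j := 0) (k := 1) hc0
  exact ⟨x, N + 2, _, 0, 1, hw, by simp, hx⟩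

end Modes

/-- `φ` is twice differentiable with derivatives `φ₁` and `φ₂`, all continuous and bounded. -/
structure IsTestFun (φ φ₁ φ₂ : ℝ → ℝ) : Prop where
  deriv₁ : ∀ y, HasDerivAt φ (φ₁ y) y
  deriv₂ : ∀ y, HasDerivAt φ₁ (φ₂ y) y
  cont : Continuous φ₂
  bound₀ : ∃ C, ∀ y, |φ y| ≤ C
  bound₁ : ∃ C, ∀ y, |φ₁ y| ≤ C
  bound₂ : ∃ C, ∀ y, |φ₂ y| ≤ C

namespace IsTestFun

variable {φ φ₁ φ₂ : ℝ → ℝ}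

lemma continuous₀ (h : IsTestFun φ φ₁ φ₂) : Continuous φ :=
  continuous_iff_continuousAt.2 fun y => (h.deriv₁ y).continuousAt

lemma continuous₁ (h : IsTestFun φ φ₁ φ₂) : Continuous φ₁ :=
  continuous_iff_continuousAt.2 fun y => (h.deriv₂ y).continuousAt

lemma neg (h : IsTestFun φ φ₁ φ₂) :
    IsTestFun (fun y => -φ y) (fun y => -φ₁ y) (fun y => -φ₂ y) :=
  ⟨fun y => (h.deriv₁ y).neg, fun y => (h.deriv₂ y).neg, h.cont.neg,
    by simpa using h.bound₀, by simpa using h.bound₁, by simpa using h.bound₂⟩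

end IsTestFun

lemma integrable_of_bound {Ω : Type*} [MeasurableSpace Ω] {P : Measure Ω} [IsFiniteMeasure P]
    {g : Ω → ℝ} (hg : AEStronglyMeasurable g P) (hb : ∃ C, ∀ y, |g y| ≤ C) : Integrable g P := by
  obtain ⟨C, hC⟩ := hb
  exact Integrable.of_bound hg C (ae_of_all _ hC)

lemma integral_gammaMeasure_one {β : ℝ} (hβ : 0 < β) (g : ℝ → ℝ) :
    ∫ y, g y ∂gammaMeasure 1 β = ∫ y in Ioi 0, β * exp (-(β * y)) * g y := by
  have hm : Measurable (gammaPDF 1 β) := (measurable_gammaPDFReal 1 β).ennreal_ofReal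
  rw [gammaMeasure, integral_withDensity_eq_integral_toReal_smul hm
    (ae_of_all _ fun _ => ENNReal.ofReal_lt_top), ← integral_Ici_eq_integral_Ioi,
    ← setIntegral_eq_integral_of_forall_compl_eq_zero (s := Ici 0)]
  · refine setIntegral_congr_fun measurableSet_Ici fun y hy => ?_
    simp only [gammaPDF]
    rw [ENNReal.toReal_ofReal (gammaPDFReal_nonneg one_pos hβ y), gammaPDFReal,
      if_pos (mem_Ici.1 hy)]
    simp
  · intro y hy
    rw [gammaPDF_of_neg (not_le.1 hy)]
    simp

/-- Integration by parts against the exponential law. -/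
lemma integral_expLaw_sub {β : ℝ} (hβ : 0 < β) {ψ ψ' : ℝ → ℝ} (hψ : ∀ y, HasDerivAt ψ (ψ' y) y)
    (hc : Continuous ψ') (hb : ∃ C, ∀ y, |ψ y| ≤ C) (hb' : ∃ C, ∀ y, |ψ' y| ≤ C) (c z : ℝ) :
    ∫ y, ψ (z + y) ∂expLaw β c - ψ z = c / β * ∫ y, ψ' (z + y) ∂expLaw β c := by
  have hψc : Continuous ψ := continuous_iff_continuousAt.2 fun y => (hψ y).continuousAt
  obtain ⟨C, hC⟩ := hb
  obtain ⟨C', hC'⟩ := hb'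
  have hInt : ∀ (g : ℝ → ℝ) (C : ℝ), Continuous g → (∀ y, |g y| ≤ C) →
      IntegrableOn (fun y => β * exp (-(β * y)) * g (z + c * y)) (Ioi 0) := fun g C hg hgC => by
    have h1 : IntegrableOn (fun y => β * exp (-(β * y))) (Ioi 0) := by
      have := (exp_neg_integrableOn_Ioi 0 hβ).const_mul β
      simp only [neg_mul] at this
      exact this
    refine h1.mul_bdd (c := C) (Continuous.aestronglyMeasurable (by fun_prop))
      (ae_of_all _ fun y => hgC _)
  have hd : ∀ y ∈ Ici (0 : ℝ), HasDerivAt (fun y => -(exp (-(β * y)) * ψ (z + c * y)))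
      (β * exp (-(β * y)) * ψ (z + c * y) - c / β * (β * exp (-(β * y)) * ψ' (z + c * y))) y := by
    intro y _
    have h1 : HasDerivAt (fun y => exp (-(β * y))) (exp (-(β * y)) * (-(β * 1))) y :=
      (((hasDerivAt_id y).const_mul β).neg).exp
    have h2 : HasDerivAt (fun y => ψ (z + c * y)) (ψ' (z + c * y) * (c * 1)) y :=
      (hψ (z + c * y)).comp y (((hasDerivAt_id y).const_mul c).const_add z)
    refine (h1.mul h2).neg.congr_deriv ?_
    field_simp
    ring
  have hlim : Tendsto (fun y => -(exp (-(β * y)) * ψ (z + c * y))) atTop (𝓝 0) := by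
    rw [← neg_zero]
    refine Tendsto.neg ?_
    have he : Tendsto (fun y => exp (-(β * y))) atTop (𝓝 0) :=
      tendsto_exp_neg_atTop_nhds_zero.comp (tendsto_id.const_mul_atTop hβ)
    refine squeeze_zero_norm (a := fun y => exp (-(β * y)) * C) (fun y => ?_)
      (by simpa using he.mul_const C)
    rw [norm_mul, norm_of_nonneg (exp_pos _).le]
    exact mul_le_mul_of_nonneg_left (hC _) (exp_pos _).le
  have hI := integral_Ioi_of_hasDerivAt_of_tendsto' hd
    ((hInt ψ C hψc hC).sub ((hInt ψ' C' hc hC').const_mul (c / β))) hlim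
  rw [integral_sub (hInt ψ C hψc hC) ((hInt ψ' C' hc hC').const_mul (c / β)),
    integral_const_mul] at hI
  rw [expLaw, integral_map (by fun_prop) (Continuous.aestronglyMeasurable (by fun_prop)),
    integral_map (by fun_prop) (Continuous.aestronglyMeasurable (by fun_prop)),
    integral_gammaMeasure_one hβ, integral_gammaMeasure_one hβ]
  simp at hI
  linarith

lemma integral_conv_expLaw_sub {β : ℝ} (hβ : 0 < β) {ψ ψ' : ℝ → ℝ}
    (hψ : ∀ y, HasDerivAt ψ (ψ' y) y) (hc : Continuous ψ') (hb : ∃ C, ∀ y, |ψ y| ≤ C)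
    (hb' : ∃ C, ∀ y, |ψ' y| ≤ C) (c : ℝ) (ν : Measure ℝ) [IsProbabilityMeasure ν] :
    ∫ y, ψ y ∂(ν ∗ expLaw β c) - ∫ y, ψ y ∂ν = c / β * ∫ y, ψ' y ∂(ν ∗ expLaw β c) := by
  have := isProbabilityMeasure_expLaw hβ c
  have hψc : Continuous ψ := continuous_iff_continuousAt.2 fun y => (hψ y).continuousAt
  have h1 : Integrable ψ (ν ∗ expLaw β c) := integrable_of_bound hψc.aestronglyMeasurable hb
  have h2 : Integrable ψ' (ν ∗ expLaw β c) := integrable_of_bound hc.aestronglyMeasurable hb'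
  have h3 : Integrable ψ ν := integrable_of_bound hψc.aestronglyMeasurable hb
  have h4 : Integrable (fun x => ∫ y, ψ (x + y) ∂expLaw β c) ν := by
    exact (integrable_of_bound (P := ν.prod (expLaw β c))
      (g := fun p : ℝ × ℝ => ψ (p.1 + p.2)) (Continuous.aestronglyMeasurable (by fun_prop))
      (hb.imp fun C hC p => hC _)).integral_prod_left
  rw [integral_conv h1, integral_conv h2, ← integral_sub h4 h3, ← integral_const_mul]
  exact integral_congr_ae (ae_of_all _ fun x => integral_expLaw_sub hβ hψ hc hb hb' c x)

lemma integral_conv_expLaw_sub_integral_conv_expLaw {β : ℝ} (hβ : 0 < β) {ψ ψ' : ℝ → ℝ}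
    (hψ : ∀ y, HasDerivAt ψ (ψ' y) y) (hc : Continuous ψ') (hb : ∃ C, ∀ y, |ψ y| ≤ C)
    (hb' : ∃ C, ∀ y, |ψ' y| ≤ C) (a b : ℝ) (ν : Measure ℝ) [IsProbabilityMeasure ν] :
    ∫ y, ψ y ∂(ν ∗ expLaw β a) - ∫ y, ψ y ∂(ν ∗ expLaw β b) =
      (a - b) / β * ∫ y, ψ' y ∂((ν ∗ expLaw β a) ∗ expLaw β b) := by
  have := isProbabilityMeasure_expLaw hβ a
  have := isProbabilityMeasure_expLaw hβ b
  have h1 := integral_conv_expLaw_sub hβ hψ hc hb hb' b (ν ∗ expLaw β a)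
  have h2 := integral_conv_expLaw_sub hβ hψ hc hb hb' a (ν ∗ expLaw β b)
  have h3 : (ν ∗ expLaw β b) ∗ expLaw β a = (ν ∗ expLaw β a) ∗ expLaw β b := by
    rw [Measure.conv_assoc, Measure.conv_comm (expLaw β b), ← Measure.conv_assoc]
  rw [h3] at h2
  rw [sub_div, sub_mul]
  linarith

lemma integrable_id_gammaMeasure {a β : ℝ} (ha : 0 < a) (hβ : 0 < β) :
    Integrable (fun x => x) (gammaMeasure a β) := by
  have := isProbabilityMeasure_gammaMeasure ha hβ
  have := isProbabilityMeasure_gammaMeasure one_pos hβ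
  rw [← lintegral_ofReal_ne_top_iff_integrable (by fun_prop)
    ((ae_gammaMeasure_pos a β).mono fun x hx => hx.le)]
  have h := congrArg (fun μ : Measure ℝ => μ univ) (gammaMeasure_withDensity_id ha hβ)
  simp only [withDensity_apply _ MeasurableSet.univ, Measure.restrict_univ] at h
  rw [h]
  simp

lemma integral_eval_mul {n : ℕ} {α β : ℝ} (hα : 0 < α) (hβ : 0 < β) (w : Fin n → ℝ) (i : Fin n)
    {ψ : ℝ → ℝ} (hψ : Continuous ψ) :
    ∫ x, x i * ψ (∑ i, w i * x i) ∂(Measure.pi fun _ : Fin n => gammaMeasure α β) =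
      α / β * ∫ y, ψ y ∂(law α β w ∗ expLaw β (w i)) := by
  have hi : Measurable fun x : Fin n → ℝ => ENNReal.ofReal (x i) := by fun_prop
  have h := map_withDensity_eval (κ := fun _ => α) (fun _ => hα) hβ w i
  have h2 : ∫ y, ψ y ∂_ = ∫ y, ψ y ∂_ := congrArg (fun μ : Measure ℝ => ∫ y, ψ y ∂μ) h
  rw [integral_map (measurable_weightedSum w).aemeasurable hψ.aestronglyMeasurable,
    integral_smul_measure, ENNReal.toReal_ofReal (by positivity),
    integral_withDensity_eq_integral_toReal_smul hi
    (ae_of_all _ fun _ => ENNReal.ofReal_lt_top)] at h2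
  rw [law_eq_genLaw, ← smul_eq_mul (α / β), ← h2]
  refine integral_congr_ae ?_
  filter_upwards [ae_pi_gammaMeasure_pos (κ := fun _ : Fin n => α) (fun _ => hα) hβ] with x hx
  rw [ENNReal.toReal_ofReal (hx i).le, smul_eq_mul]

lemma hasDerivAt_integral_path {n : ℕ} {α β : ℝ} (hα : 0 < α) (hβ : 0 < β) (v d : Fin n → ℝ)
    {φ φ₁ φ₂ : ℝ → ℝ} (h : IsTestFun φ φ₁ φ₂) (t : ℝ) :
    HasDerivAt (fun t => ∫ y, φ y ∂law α β (fun i => v i + t * d i))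
      (α / β * ∑ i, d i * ∫ y, φ₁ y ∂(law α β (fun i => v i + t * d i) ∗
        expLaw β (v i + t * d i))) t := by
  have := isProbabilityMeasure_gammaMeasure hα hβ
  have hlaw : ∀ t, ∫ y, φ y ∂law α β (fun i => v i + t * d i) =
      ∫ x, φ (∑ i, (v i + t * d i) * x i) ∂(Measure.pi fun _ : Fin n => gammaMeasure α β) :=
    fun t => integral_map (measurable_weightedSum _).aemeasurable
      h.continuous₀.aestronglyMeasurable
  simp_rw [hlaw]
  have hxi : ∀ i : Fin n, Integrable (fun x : Fin n → ℝ => x i)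
      (Measure.pi fun _ : Fin n => gammaMeasure α β) := fun i =>
    (measurePreserving_eval (fun _ : Fin n => gammaMeasure α β) i).integrable_comp_of_integrable
      (integrable_id_gammaMeasure hα hβ)
  have hφc := h.continuous₀
  have hφ₁c := h.continuous₁
  obtain ⟨C, hC⟩ := h.bound₁
  have hC0 : 0 ≤ C := (abs_nonneg _).trans (hC 0)
  have key := (hasDerivAt_integral_of_dominated_loc_of_deriv_le
    (μ := Measure.pi fun _ : Fin n => gammaMeasure α β)
    (F := fun t x => φ (∑ i, (v i + t * d i) * x i))
    (F' := fun t x => φ₁ (∑ i, (v i + t * d i) * x i) * ∑ i, d i * x i)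
    (bound := fun x => C * ∑ i, |d i * x i|) (x₀ := t) (s := univ) univ_mem
    (Eventually.of_forall fun t => Continuous.aestronglyMeasurable (by fun_prop))
    (integrable_of_bound (Continuous.aestronglyMeasurable (by fun_prop))
      (h.bound₀.imp fun C hC x => hC _))
    (Continuous.aestronglyMeasurable (by fun_prop))
    (ae_of_all _ fun x t _ => ?_)
    ((integrable_finsetSum _ fun i _ => ((hxi i).const_mul (d i)).abs).const_mul C)
    (ae_of_all _ fun x t _ => ?_)).2
  · refine key.congr_deriv ?_
    have h1 : ∀ x : Fin n → ℝ, φ₁ (∑ i, (v i + t * d i) * x i) * ∑ i, d i * x i =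
        ∑ i, d i * (x i * φ₁ (∑ i, (v i + t * d i) * x i)) := fun x => by
      rw [Finset.mul_sum]
      exact Finset.sum_congr rfl fun i _ => by ring
    simp_rw [h1]
    rw [integral_finsetSum _ fun i _ => ?_, Finset.mul_sum]
    · refine Finset.sum_congr rfl fun i _ => ?_
      rw [integral_const_mul, integral_eval_mul hα hβ (fun i => v i + t * d i) i hφ₁c]
      ring
    · refine Integrable.const_mul ?_ _
      exact (hxi i).mul_bdd (c := C) (Continuous.aestronglyMeasurable (by fun_prop))
        (ae_of_all _ fun x => hC _)
  · rw [norm_mul]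
    exact mul_le_mul (hC _) (Finset.abs_sum_le_sum_abs _ _) (norm_nonneg _) hC0
  · refine (h.deriv₁ _).comp t (HasDerivAt.fun_sum fun i _ => ?_)
    have := (((hasDerivAt_id t).mul_const (d i)).const_add (v i)).mul_const (x i)
    simpa using this

lemma sum_mul_nonneg_of_partialSums_nonpos {N : ℕ} {d A : ℕ → ℝ}
    (hd : ∀ k ≤ N, ∑ i ∈ Finset.range k, d i ≤ 0) (hd0 : ∑ i ∈ Finset.range N, d i = 0)
    (hA : ∀ k, k + 1 < N → A k ≤ A (k + 1)) : 0 ≤ ∑ i ∈ Finset.range N, d i * A i := by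
  have := Finset.sum_range_by_parts A d N
  simp only [smul_eq_mul, hd0, mul_zero, zero_sub] at this
  simp_rw [mul_comm (d _)]
  rw [this, ← Finset.sum_neg_distrib]
  refine Finset.sum_nonneg fun k hk => ?_
  rw [Finset.mem_range] at hk
  have h1 := hd (k + 1) (by omega)
  have h2 := hA k (by omega)
  nlinarith

section Sorted

variable {n : ℕ} (v : Fin n → ℝ)

lemma sorted_of_lt {i : ℕ} (h : i < n) :
    sorted v i = v (Tuple.sort (fun a => -v a) ⟨i, h⟩) := dif_pos h

lemma sorted_of_ge {i : ℕ} (h : n ≤ i) : sorted v i = 0 := dif_neg h.not_gt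

@[to_additive]
lemma prod_sorted {M : Type*} [CommMonoid M] (g : ℝ → M) (hg : g 0 = 1) {N : ℕ} (hN : n ≤ N) :
    ∏ i ∈ Finset.range N, g (sorted v i) = ∏ i, g (v i) := by
  rw [← Finset.prod_subset (Finset.range_mono hN) fun i _ hi => by
    rw [sorted_of_ge v (by simpa using hi), hg], Finset.prod_range,
    ← Equiv.prod_comp (Tuple.sort fun a => -v a) fun i => g (v i)]
  exact Finset.prod_congr rfl fun i _ => by rw [sorted_of_lt v i.2]

variable {v}

lemma sorted_le {c : ℝ} (hc : 0 ≤ c) (hv : ∀ i, v i ≤ c) (i : ℕ) : sorted v i ≤ c := by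
  rcases lt_or_ge i n with h | h
  · rw [sorted_of_lt v h]
    exact hv _
  · rwa [sorted_of_ge v h]

lemma sorted_nonneg (hv : ∀ i, 0 ≤ v i) (i : ℕ) : 0 ≤ sorted v i := by
  rcases lt_or_ge i n with h | h
  · rw [sorted_of_lt v h]
    exact hv _
  · rw [sorted_of_ge v h]

lemma sorted_antitone (hv : ∀ i, 0 ≤ v i) : Antitone (sorted v) := by
  intro i j hij
  rcases lt_or_ge j n with h | h
  · rw [sorted_of_lt v h, sorted_of_lt v (hij.trans_lt h)]
    have := Tuple.monotone_sort (fun a => -v a)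
      (show (⟨i, hij.trans_lt h⟩ : Fin n) ≤ ⟨j, h⟩ from hij)
    simpa using this
  · rw [sorted_of_ge v h]
    exact sorted_nonneg hv i

lemma law_sorted {α β : ℝ} (hα : 0 < α) (hβ : 0 < β) (v : Fin n → ℝ) {N : ℕ} (hN : n ≤ N) :
    law α β (fun i : Fin N => sorted v i) = law α β v := by
  have := isProbabilityMeasure_gammaMeasure hα hβ
  have := isProbabilityMeasure_genLaw (fun _ => hα) hβ v
  have := isProbabilityMeasure_genLaw (fun _ => hα) hβ (fun i : Fin N => sorted v i)
  rw [law_eq_genLaw, law_eq_genLaw]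
  refine Measure.ext_of_charFun (funext fun t => ?_)
  rw [charFun_genLaw (fun _ => hα) hβ, charFun_genLaw (fun _ => hα) hβ,
    ← prod_sorted v (fun x => charFun (gammaMeasure α β) (x * t)) (by simp) hN, Finset.prod_range]

lemma memQrel_sorted {m α β : ℝ} (hm : 0 < m) (hα : 0 < α) (hβ : 0 < β) (hv : MemQrel m α β v)
    {N : ℕ} (hN : n ≤ N) : MemQrel m α β (fun i : Fin N => sorted v i) := by
  rw [memQrel_iff hm hα hβ] at hv ⊢
  refine ⟨fun i => sorted_nonneg hv.1 i, fun i => sorted_le (by positivity) hv.2.1 i, ?_⟩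
  rw [← hv.2.2, ← sum_sorted v (fun x => x) rfl hN, Finset.sum_range]

end Sorted

lemma MemQrel.segment {m α β : ℝ} (hm : 0 < m) (hα : 0 < α) (hβ : 0 < β) {n : ℕ}
    {v u : Fin n → ℝ} (hv : MemQrel m α β v) (hu : MemQrel m α β u) {t : ℝ} (ht : t ∈ Icc 0 1) :
    MemQrel m α β (fun i => v i + t * (u i - v i)) := by
  rw [memQrel_iff hm hα hβ] at *
  obtain ⟨ht0, ht1⟩ := ht
  refine ⟨fun i => ?_, fun i => ?_, ?_⟩
  · nlinarith [hv.1 i, hu.1 i]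
  · nlinarith [hv.2.1 i, hu.2.1 i]
  · rw [Finset.sum_add_distrib, ← Finset.mul_sum, Finset.sum_sub_distrib, hv.2.2, hu.2.2]
    ring

/-- Expectations of a test function increase from the majorizing to the majorized combination,
provided its second derivative has nonpositive mean under the laws of
`Q_w + w j * ψ + w k * ψ'`. -/
theorem integral_law_le_of_majorizes {m α β : ℝ} (hm : 0 < m) (hα : 0 < α) (hβ : 0 < β)
    {n₁ n₂ : ℕ} {u : Fin n₁ → ℝ} {v : Fin n₂ → ℝ} (hu : MemQrel m α β u) (hv : MemQrel m α β v)
    (huv : Majorizes v u) {φ φ₁ φ₂ : ℝ → ℝ} (hφ : IsTestFun φ φ₁ φ₂)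
    (hneg : ∀ (n : ℕ) (w : Fin n → ℝ) (j k : Fin n), MemQrel m α β w → j ≠ k → w k < w j →
      ∫ y, φ₂ y ∂lawAdd α β w j k ≤ 0) :
    ∫ y, φ y ∂law α β v ≤ ∫ y, φ y ∂law α β u := by
  set N := max n₁ n₂ with hN
  have h1N : n₁ ≤ N := le_max_left _ _
  have h2N : n₂ ≤ N := le_max_right _ _
  have hu' := memQrel_sorted hm hα hβ hu h1N
  have hv' := memQrel_sorted hm hα hβ hv h2N
  set d : ℕ → ℝ := fun i => sorted u i - sorted v i with hd
  have hderiv := fun t => hasDerivAt_integral_path hα hβ (fun i : Fin N => sorted v i)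
    (fun i : Fin N => d i) hφ t
  have hmono : MonotoneOn (fun t => ∫ y, φ y ∂law α β
      (fun i : Fin N => sorted v i + t * d i)) (Icc 0 1) := by
    refine monotoneOn_of_deriv_nonneg (convex_Icc 0 1)
      (fun t _ => (hderiv t).continuousAt.continuousWithinAt)
      (fun t _ => (hderiv t).differentiableAt.differentiableWithinAt) fun t ht => ?_
    have ht' : t ∈ Icc (0 : ℝ) 1 := interior_subset ht
    rw [(hderiv t).deriv]
    refine mul_nonneg (by positivity) ?_
    set γ : ℕ → ℝ := fun i => sorted v i + t * d i with hγ
    have hγm : MemQrel m α β (fun i : Fin N => γ i) := MemQrel.segment hm hα hβ hv' hu' ht'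
    have : IsProbabilityMeasure (law α β (fun i : Fin N => γ i)) :=
      isProbabilityMeasure_genLaw (fun _ => hα) hβ _
    have hsum := Finset.sum_range (n := N) (fun i => d i * ∫ y, φ₁ y ∂(law α β
      (fun i : Fin N => γ i) ∗ expLaw β (γ i)))
    refine le_of_le_of_eq ?_ hsum
    refine sum_mul_nonneg_of_partialSums_nonpos (fun k hk => ?_) ?_ fun k hk => ?_
    · rw [Finset.sum_sub_distrib, sub_nonpos]
      exact huv.1 k hk
    · rw [Finset.sum_sub_distrib, sum_sorted u (fun x => x) rfl h1N,
        sum_sorted v (fun x => x) rfl h2N, huv.2, sub_self]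
    · rw [← sub_nonpos, integral_conv_expLaw_sub_integral_conv_expLaw hβ hφ.deriv₂ hφ.cont
        hφ.bound₁ hφ.bound₂]
      have hle : γ (k + 1) ≤ γ k := by
        have h1 := sorted_antitone hu.nonneg (Nat.le_succ k)
        have h2 := sorted_antitone hv.nonneg (Nat.le_succ k)
        simp only [hγ, hd]
        nlinarith [ht'.1, ht'.2]
      rcases hle.eq_or_lt with heq | hlt
      · simp [heq]
      · refine mul_nonpos_of_nonneg_of_nonpos (div_nonneg (by linarith) hβ.le) ?_
        have := hneg N (fun i : Fin N => γ i) ⟨k, by omega⟩ ⟨k + 1, hk⟩ hγm (by simp) hlt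
        rwa [lawAdd_eq_conv hα hβ] at this
  have h01 := hmono (left_mem_Icc.2 zero_le_one) (right_mem_Icc.2 zero_le_one) zero_le_one
  simpa [hd, law_sorted hα hβ v h2N, law_sorted hα hβ u h1N] using h01

section SmoothStep

lemma deriv_smoothTransition_nonneg (s : ℝ) : 0 ≤ deriv smoothTransition s :=
  Real.smoothTransition.monotone.deriv_nonneg

lemma deriv_smoothTransition_of_nonpos {s : ℝ} (hs : s ≤ 0) : deriv smoothTransition s = 0 := by
  refine IsLocalMin.deriv_eq_zero (Eventually.of_forall fun y => ?_)
  rw [Real.smoothTransition.zero_of_nonpos hs]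
  exact Real.smoothTransition.nonneg y

lemma deriv_smoothTransition_of_one_le {s : ℝ} (hs : 1 ≤ s) : deriv smoothTransition s = 0 := by
  refine IsLocalMax.deriv_eq_zero (Eventually.of_forall fun y => ?_)
  rw [Real.smoothTransition.one_of_one_le hs]
  exact Real.smoothTransition.le_one y

lemma hasDerivAt_smoothTransition (s : ℝ) :
    HasDerivAt smoothTransition (deriv smoothTransition s) s :=
  ((Real.smoothTransition.contDiff (n := 1)).differentiable one_ne_zero s).hasDerivAt

lemma continuous_deriv_smoothTransition : Continuous (deriv smoothTransition) :=
  (Real.smoothTransition.contDiff (n := 1)).continuous_deriv le_rfl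

lemma exists_bound_deriv_smoothTransition : ∃ C, ∀ s, |deriv smoothTransition s| ≤ C := by
  obtain ⟨C, hC⟩ := isCompact_Icc.exists_bound_of_continuousOn (s := Icc (0 : ℝ) 1)
    continuous_deriv_smoothTransition.continuousOn
  refine ⟨C, fun s => ?_⟩
  by_cases hs : s ∈ Icc (0 : ℝ) 1
  · exact hC s hs
  · have h0 : deriv smoothTransition s = 0 := by
      rw [mem_Icc, not_and_or, not_le, not_le] at hs
      rcases hs with h | h
      · exact deriv_smoothTransition_of_nonpos h.le
      · exact deriv_smoothTransition_of_one_le h.le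
    rw [h0, abs_zero]
    exact (norm_nonneg _).trans (hC 0 (left_mem_Icc.2 zero_le_one))

/-- The average of the smooth transition function over `[z - 1, z]`. -/
noncomputable def smoothStep (z : ℝ) : ℝ := ∫ s in (z - 1)..z, smoothTransition s

lemma hasDerivAt_smoothStep (z : ℝ) :
    HasDerivAt smoothStep (smoothTransition z - smoothTransition (z - 1)) z := by
  have hc := Real.smoothTransition.continuous
  have h1 : ∀ z, HasDerivAt (fun z => ∫ s in (0 : ℝ)..z, smoothTransition s)
      (smoothTransition z) z := fun z =>
    intervalIntegral.integral_hasDerivAt_right (hc.intervalIntegrable _ _)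
      (hc.stronglyMeasurableAtFilter _ _) hc.continuousAt
  have h2 : smoothStep = fun z => (∫ s in (0 : ℝ)..z, smoothTransition s) -
      ∫ s in (0 : ℝ)..(z - 1), smoothTransition s := by
    ext z
    rw [smoothStep, intervalIntegral.integral_interval_sub_left (hc.intervalIntegrable _ _)
      (hc.intervalIntegrable _ _)]
  rw [h2]
  exact (h1 z).sub ((h1 (z - 1)).comp_sub_const z 1)

lemma smoothStep_nonneg (z : ℝ) : 0 ≤ smoothStep z :=
  intervalIntegral.integral_nonneg (by linarith) fun s _ => Real.smoothTransition.nonneg s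

lemma smoothStep_le_one (z : ℝ) : smoothStep z ≤ 1 := by
  have h := intervalIntegral.integral_mono_on (a := z - 1) (b := z) (by linarith)
    (Real.smoothTransition.continuous.intervalIntegrable _ _)
    (continuous_const.intervalIntegrable (μ := volume) _ _)
    fun s _ => Real.smoothTransition.le_one s
  simpa [smoothStep] using h

lemma smoothStep_of_nonpos {z : ℝ} (hz : z ≤ 0) : smoothStep z = 0 := by
  rw [smoothStep, intervalIntegral.integral_congr (g := fun _ => 0)]
  · simp
  · intro s hs
    rw [uIcc_of_le (by linarith)] at hs
    exact Real.smoothTransition.zero_of_nonpos (hs.2.trans hz)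

lemma smoothStep_of_two_le {z : ℝ} (hz : 2 ≤ z) : smoothStep z = 1 := by
  rw [smoothStep, intervalIntegral.integral_congr (g := fun _ => 1)]
  · simp
  · intro s hs
    rw [uIcc_of_le (by linarith)] at hs
    exact Real.smoothTransition.one_of_one_le (by linarith [hs.1])

/-- A smooth approximation of the indicator of `(-∞, c]`, falling from one to zero on
`[c, c + 2 * δ]`. -/
noncomputable def cutoff (c δ y : ℝ) : ℝ := 1 - smoothStep ((y - c) / δ)

/-- The second derivative of `cutoff`. -/
noncomputable def cutoffDeriv₂ (c δ y : ℝ) : ℝ :=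
  -((deriv smoothTransition ((y - c) / δ) - deriv smoothTransition ((y - c) / δ - 1)) / δ) / δ

lemma isTestFun_cutoff (c δ : ℝ) :
    IsTestFun (cutoff c δ)
      (fun y => -(smoothTransition ((y - c) / δ) - smoothTransition ((y - c) / δ - 1)) / δ)
      (cutoffDeriv₂ c δ) := by
  have hz : ∀ y, HasDerivAt (fun y => (y - c) / δ) (1 / δ) y := fun y =>
    ((hasDerivAt_id y).sub_const c).div_const δ
  have hHc := continuous_deriv_smoothTransition
  obtain ⟨C, hC⟩ := exists_bound_deriv_smoothTransition
  refine ⟨fun y => ?_, fun y => ?_, ?_, ⟨1, fun y => ?_⟩, ⟨2 / |δ|, fun y => ?_⟩,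
    ⟨(C + C) / |δ| / |δ|, fun y => ?_⟩⟩
  · refine (((hasDerivAt_smoothStep _).comp y (hz y)).const_sub 1).congr_deriv ?_
    ring
  · have h1 := (hasDerivAt_smoothTransition ((y - c) / δ)).comp y (hz y)
    have h2 := (hasDerivAt_smoothTransition ((y - c) / δ - 1)).comp y ((hz y).sub_const 1)
    refine ((h1.sub h2).neg.div_const δ).congr_deriv ?_
    rw [cutoffDeriv₂]
    ring
  · unfold cutoffDeriv₂
    fun_prop
  · rw [cutoff, abs_le]
    constructor <;> linarith [smoothStep_nonneg ((y - c) / δ), smoothStep_le_one ((y - c) / δ)]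
  · rw [abs_div, abs_neg]
    gcongr
    rw [abs_le]
    constructor <;> linarith [Real.smoothTransition.nonneg ((y - c) / δ),
      Real.smoothTransition.le_one ((y - c) / δ), Real.smoothTransition.nonneg ((y - c) / δ - 1),
      Real.smoothTransition.le_one ((y - c) / δ - 1)]
  · rw [cutoffDeriv₂, abs_div, abs_neg, abs_div]
    gcongr
    exact (abs_sub _ _).trans (add_le_add (hC _) (hC _))

lemma measureReal_Iic_le_integral_cutoff {P : Measure ℝ} [IsProbabilityMeasure P] {c δ : ℝ}
    (hδ : 0 < δ) : P.real (Iic c) ≤ ∫ y, cutoff c δ y ∂P := by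
  have hφ := isTestFun_cutoff c δ
  rw [← integral_indicator_one measurableSet_Iic]
  refine integral_mono ((integrable_const 1).indicator measurableSet_Iic)
    (integrable_of_bound hφ.continuous₀.aestronglyMeasurable hφ.bound₀) fun y => ?_
  by_cases hy : y ∈ Iic c
  · rw [indicator_of_mem hy, cutoff, smoothStep_of_nonpos
      (div_nonpos_of_nonpos_of_nonneg (sub_nonpos.2 hy) hδ.le)]
    simp
  · rw [indicator_of_notMem hy, cutoff]
    linarith [smoothStep_le_one ((y - c) / δ)]

lemma integral_cutoff_le_measureReal_Iic {P : Measure ℝ} [IsProbabilityMeasure P] {c δ : ℝ}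
    (hδ : 0 < δ) : ∫ y, cutoff c δ y ∂P ≤ P.real (Iic (c + 2 * δ)) := by
  have hφ := isTestFun_cutoff c δ
  rw [← integral_indicator_one measurableSet_Iic]
  refine integral_mono (integrable_of_bound hφ.continuous₀.aestronglyMeasurable hφ.bound₀)
    ((integrable_const 1).indicator measurableSet_Iic) fun y => ?_
  by_cases hy : y ∈ Iic (c + 2 * δ)
  · rw [indicator_of_mem hy, cutoff, Pi.one_apply]
    linarith [smoothStep_nonneg ((y - c) / δ)]
  · rw [indicator_of_notMem hy, cutoff, smoothStep_of_two_le]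
    · simp
    · rw [le_div_iff₀ hδ]
      have := not_le.1 (mt mem_Iic.2 hy)
      linarith

lemma integral_cutoffDeriv₂ {P : Measure ℝ} [IsProbabilityMeasure P] {c δ : ℝ} (hδ : 0 < δ) :
    ∫ y, cutoffDeriv₂ c δ y ∂P =
      ((∫⁻ y, ENNReal.ofReal (deriv smoothTransition ((y - δ - c) / δ)) ∂P).toReal -
        (∫⁻ y, ENNReal.ofReal (deriv smoothTransition ((y - c) / δ)) ∂P).toReal) / δ ^ 2 := by
  have hHc := continuous_deriv_smoothTransition
  have hb := exists_bound_deriv_smoothTransition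
  have h1 : ∀ y, cutoffDeriv₂ c δ y =
      (deriv smoothTransition ((y - δ - c) / δ) - deriv smoothTransition ((y - c) / δ)) /
        δ ^ 2 := fun y => by
    have : (y - δ - c) / δ = (y - c) / δ - 1 := by field_simp; ring
    rw [cutoffDeriv₂, this]
    field_simp
    ring
  simp_rw [h1]
  rw [integral_div, integral_sub
    (integrable_of_bound (Continuous.aestronglyMeasurable (by fun_prop))
      (hb.imp fun C hC y => hC _))
    (integrable_of_bound (Continuous.aestronglyMeasurable (by fun_prop))
      (hb.imp fun C hC y => hC _)),
    integral_eq_lintegral_of_nonneg_ae (ae_of_all _ fun y => deriv_smoothTransition_nonneg _)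
      (Continuous.aestronglyMeasurable (by fun_prop)),
    integral_eq_lintegral_of_nonneg_ae (ae_of_all _ fun y => deriv_smoothTransition_nonneg _)
      (Continuous.aestronglyMeasurable (by fun_prop))]

lemma lintegral_deriv_smoothTransition_ne_top {P : Measure ℝ} [IsProbabilityMeasure P]
    (g : ℝ → ℝ) : ∫⁻ y, ENNReal.ofReal (deriv smoothTransition (g y)) ∂P ≠ ⊤ := by
  obtain ⟨C, hC⟩ := exists_bound_deriv_smoothTransition
  refine ne_top_of_le_ne_top (b := ENNReal.ofReal C) ENNReal.ofReal_ne_top ?_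
  refine (lintegral_mono fun y => ENNReal.ofReal_le_ofReal
    ((le_abs_self _).trans (hC (g y)))).trans ?_
  simp

lemma IsMode.integral_cutoffDeriv₂_nonpos {P : Measure ℝ} [IsProbabilityMeasure P] {x c δ : ℝ}
    (h : IsMode P x) (hδ : 0 < δ) (hx : x ≤ c) : ∫ y, cutoffDeriv₂ c δ y ∂P ≤ 0 := by
  have hHc := continuous_deriv_smoothTransition.measurable
  rw [integral_cutoffDeriv₂ hδ]
  refine div_nonpos_of_nonpos_of_nonneg (sub_nonpos.2 ?_) (sq_nonneg δ)
  refine ENNReal.toReal_mono (lintegral_deriv_smoothTransition_ne_top _) ?_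
  refine h.lintegral_shift_le_lintegral hδ
    (ρ := fun y => ENNReal.ofReal (deriv smoothTransition ((y - c) / δ))) (by fun_prop)
    fun y hy => ?_
  rw [deriv_smoothTransition_of_nonpos
    (div_nonpos_of_nonpos_of_nonneg (by linarith) hδ.le), ENNReal.ofReal_zero]

lemma IsMode.integral_cutoffDeriv₂_nonneg {P : Measure ℝ} [IsProbabilityMeasure P] {x c δ : ℝ}
    (h : IsMode P x) (hδ : 0 < δ) (hx : c + 2 * δ ≤ x) : 0 ≤ ∫ y, cutoffDeriv₂ c δ y ∂P := by
  have hHc := continuous_deriv_smoothTransition.measurable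
  rw [integral_cutoffDeriv₂ hδ]
  refine div_nonneg (sub_nonneg.2 ?_) (sq_nonneg δ)
  refine ENNReal.toReal_mono (lintegral_deriv_smoothTransition_ne_top _) ?_
  refine h.lintegral_le_lintegral_shift hδ
    (ρ := fun y => ENNReal.ofReal (deriv smoothTransition ((y - c) / δ))) (by fun_prop)
    fun y hy => ?_
  rw [deriv_smoothTransition_of_one_le, ENNReal.ofReal_zero]
  rw [le_div_iff₀ hδ]
  linarith

end SmoothStep

lemma measureReal_Iic_le_of_forall_gt {P : Measure ℝ} [IsProbabilityMeasure P] {x r : ℝ}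
    (h : ∀ y, x < y → r ≤ P.real (Iic y)) : r ≤ P.real (Iic x) := by
  have hc := (cdf P).right_continuous x
  rw [← cdf_eq_real]
  refine ge_of_tendsto (hc.tendsto.mono_left (nhdsWithin_mono x Ioi_subset_Ici_self)) ?_
  filter_upwards [self_mem_nhdsWithin] with y hy
  rw [cdf_eq_real]
  exact h y hy

lemma measureReal_Iic_le_of_forall_lt {P : Measure ℝ} [IsProbabilityMeasure P] {x r : ℝ}
    (h0 : P {x} = 0) (h : ∀ y, y < x → P.real (Iic y) ≤ r) : P.real (Iic x) ≤ r := by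
  have h1 : (cdf P).measure {x} = 0 := by rwa [measure_cdf]
  rw [StieltjesFunction.measure_singleton, ENNReal.ofReal_eq_zero, sub_nonpos] at h1
  rw [← cdf_eq_real]
  refine h1.trans (le_of_tendsto ((cdf P).mono.tendsto_leftLim x) ?_)
  filter_upwards [self_mem_nhdsWithin] with y hy
  rw [cdf_eq_real]
  exact h y hy

section Comparison

variable {m α β : ℝ} {n₁ n₂ : ℕ} {u : Fin n₁ → ℝ} {v : Fin n₂ → ℝ}

lemma exists_mode_mem_modes (hm : 0 < m) (hα : 0 < α) (hβ : 0 < β) {n : ℕ} {w : Fin n → ℝ}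
    {j k : Fin n} (hw : MemQrel m α β w) (hjk : j ≠ k) (hlt : w k < w j) :
    ∃ x ∈ Icc (xLower m α β) (xUpper m α β), IsMode (lawAdd α β w j k) x := by
  obtain ⟨x, hx⟩ := exists_isMode_lawAdd hα hβ hw.nonneg (k := k) ((hw.nonneg k).trans_lt hlt)
  have hmem : x ∈ modes m α β := ⟨n, w, j, k, hw, hjk, hx⟩
  have hsub := modes_subset_Icc hα hm hβ
  exact ⟨x, ⟨csInf_le (bddBelow_Icc.mono hsub) hmem, le_csSup (bddAbove_Icc.mono hsub) hmem⟩, hx⟩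

theorem measureReal_Iic_le_of_xUpper_le (hm : 0 < m) (hα : 0 < α) (hβ : 0 < β)
    (hu : MemQrel m α β u) (hv : MemQrel m α β v) (huv : Majorizes v u) {x : ℝ}
    (hx : xUpper m α β ≤ x) : (law α β v).real (Iic x) ≤ (law α β u).real (Iic x) := by
  have : IsProbabilityMeasure (law α β v) := isProbabilityMeasure_genLaw (fun _ => hα) hβ v
  have : IsProbabilityMeasure (law α β u) := isProbabilityMeasure_genLaw (fun _ => hα) hβ u
  refine measureReal_Iic_le_of_forall_gt fun y hy => ?_
  have hδ : 0 < (y - x) / 2 := by linarith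
  have hδ' : x + 2 * ((y - x) / 2) = y := by ring
  have h := integral_law_le_of_majorizes hm hα hβ hu hv huv (isTestFun_cutoff x ((y - x) / 2))
    fun n w j k hw hjk hlt => by
      obtain ⟨x₀, hx₀, hmode⟩ := exists_mode_mem_modes hm hα hβ hw hjk hlt
      have := isProbabilityMeasure_lawAdd hα hβ w j k
      exact hmode.integral_cutoffDeriv₂_nonpos hδ (hx₀.2.trans hx)
  have h2 := integral_cutoff_le_measureReal_Iic (P := law α β u) (c := x) hδ
  rw [hδ'] at h2
  exact (measureReal_Iic_le_integral_cutoff hδ).trans (h.trans h2)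

theorem measureReal_Iic_le_of_le_xLower (hm : 0 < m) (hα : 0 < α) (hβ : 0 < β)
    (hu : MemQrel m α β u) (hv : MemQrel m α β v) (huv : Majorizes v u) {x : ℝ}
    (hx : x ≤ xLower m α β) : (law α β u).real (Iic x) ≤ (law α β v).real (Iic x) := by
  have : IsProbabilityMeasure (law α β v) := isProbabilityMeasure_genLaw (fun _ => hα) hβ v
  have : IsProbabilityMeasure (law α β u) := isProbabilityMeasure_genLaw (fun _ => hα) hβ u
  have hus := ((memQrel_iff hm hα hβ).1 hu).2.2
  obtain ⟨i, -, hi⟩ : ∃ i ∈ Finset.univ, 0 < u i :=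
    Finset.exists_lt_of_sum_lt (by simpa [hus] using div_pos hβ hα)
  refine measureReal_Iic_le_of_forall_lt (law_singleton hα hβ hu.nonneg hi x) fun y hy => ?_
  have hδ : 0 < (x - y) / 2 := by linarith
  have hδ' : y + 2 * ((x - y) / 2) = x := by ring
  have h := integral_law_le_of_majorizes hm hα hβ hu hv huv
    (isTestFun_cutoff y ((x - y) / 2)).neg fun n w j k hw hjk hlt => by
      obtain ⟨x₀, hx₀, hmode⟩ := exists_mode_mem_modes hm hα hβ hw hjk hlt
      have := isProbabilityMeasure_lawAdd hα hβ w j k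
      rw [integral_neg, neg_nonpos]
      exact hmode.integral_cutoffDeriv₂_nonneg hδ (by linarith [hx₀.1])
  rw [integral_neg, integral_neg, neg_le_neg_iff] at h
  have h2 := integral_cutoff_le_measureReal_Iic (P := law α β v) (c := y) hδ
  rw [hδ'] at h2
  exact (measureReal_Iic_le_integral_cutoff hδ).trans (h.trans h2)

end Comparison

end GammaMix

theorem mainTheorem2 (m α β : ℝ) (hα : 0 < α) (hm : α ≤ m) (hβ : 0 < β) :
    ((GammaMix.modes m α β).Nonempty ∧ BddAbove (GammaMix.modes m α β) ∧
      BddBelow (GammaMix.modes m α β)) ∧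
    ∀ (n₁ n₂ : ℕ) (u : Fin n₁ → ℝ) (v : Fin n₂ → ℝ),
      GammaMix.MemQrel m α β u → GammaMix.MemQrel m α β v → GammaMix.Majorizes v u →
      (∀ x : ℝ, GammaMix.xUpper m α β ≤ x →
        (GammaMix.law α β v).real (Set.Iic x) ≤ (GammaMix.law α β u).real (Set.Iic x)) ∧
      (∀ x : ℝ, x ≤ GammaMix.xLower m α β →
        (GammaMix.law α β u).real (Set.Iic x) ≤ (GammaMix.law α β v).real (Set.Iic x)) := by
  have hm0 : 0 < m := hα.trans_le hm
  have hsub := GammaMix.modes_subset_Icc hα hm0 hβ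
  refine ⟨⟨GammaMix.modes_nonempty hα hm0 hβ, bddAbove_Icc.mono hsub, bddBelow_Icc.mono hsub⟩,
    fun n₁ n₂ u v hu hv huv => ⟨fun x hx => ?_, fun x hx => ?_⟩⟩
  · exact GammaMix.measureReal_Iic_le_of_xUpper_le hm0 hα hβ hu hv huv hx
  · exact GammaMix.measureReal_Iic_le_of_le_xLower hm0 hα hβ hu hv huv hx
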